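/- Let $G=(V,E)$ be a finite connected simple graph. For $v\in V$ and an edge $e=uw\in E$ put $d_G(e,v)=\min\{d_G(u,v),d_G(w,v)\}$. A set $S\subseteq V$ is an edge metric generator for $G$ if for every two different edges $e_1,e_2\in E$ there is $v\in S$ with $d_G(e_1,v)\neq d_G(e_2,v)$, and $\mathrm{edim}(G)$ is the smallest cardinality of an edge metric generator for $G$. Theorem. The edge metric dimension can be approximated within a factor of $O(\log m)$ in polynomial time: there are an absolute constant $C$ and a deterministic polynomial-time algorithm (a multi-stack Turing machine whose running time is bounded by a polynomial in the length of its input) that, given any finite connected graph $G$ (presented by the number of its vertices in unary and its adjacency matrix), outputs (the characteristic vector of) an edge metric generator $S$ for $G$ with $$\mathrm{edim}(G)\le |S|\le C\,\log(m)\cdot \mathrm{edim}(G),$$ where $m=|E|$. (If $m\le 1$, then $\mathrm{edim}(G)=0$, the right-hand side is read as $0$, and $S=\emptyset$.) -/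

import Mathlib

namespace EdgeMetric

/-- The distance between the vertex `v` and the edge `e = uw`:
`d(e, v) = min (d(u, v)) (d(w, v))`. -/
noncomputable def edgeDist {V : Type*} (G : SimpleGraph V) (e : Sym2 V) (v : V) : ℕ :=
  Sym2.lift ⟨fun u w => min (G.dist u v) (G.dist w v), fun _ _ => min_comm _ _⟩ e

/-- The vertex `v` distinguishes the edges `e₁` and `e₂`. -/
def Distinguishes {V : Type*} (G : SimpleGraph V) (v : V) (e₁ e₂ : Sym2 V) : Prop :=
  edgeDist G e₁ v ≠ edgeDist G e₂ v

/-- `S` is an edge metric generator for `G`: every two different edges of `G` are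
distinguished by some vertex of `S`. -/
def IsEdgeMetricGenerator {V : Type*} (G : SimpleGraph V) (S : Finset V) : Prop :=
  ∀ e₁ ∈ G.edgeSet, ∀ e₂ ∈ G.edgeSet, e₁ ≠ e₂ → ∃ v ∈ S, Distinguishes G v e₁ e₂

/-- The edge metric dimension: the smallest cardinality of an edge metric generator.
In a finite connected graph the set of all vertices is one, so the infimum is attained. -/
noncomputable def edim {V : Type*} (G : SimpleGraph V) : ℕ :=
  sInf {k : ℕ | ∃ S : Finset V, IsEdgeMetricGenerator G S ∧ S.card = k}

/-- The instances of the problem: finite connected simple graphs, with vertices `0, …, n - 1`. -/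
structure ConnectedGraph where
  /-- the number of vertices -/
  order : ℕ
  graph : SimpleGraph (Fin order)
  connected : graph.Connected

/-- The number of edges. -/
noncomputable def ConnectedGraph.size (X : ConnectedGraph) : ℕ := X.graph.edgeSet.ncard

open Classical in
/-- The binary string that presents a graph to a machine: the number `n` of vertices in unary,
ended by a `0`, and then the `n × n` adjacency matrix, row by row. -/
noncomputable def encodeGraph (X : ConnectedGraph) : List Bool :=
  List.replicate X.order true ++
    false :: (List.ofFn fun i => List.ofFn fun j => decide (X.graph.Adj i j)).flatten

/-- The binary string that presents a set of vertices: its characteristic vector. -/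
def encodeVertexSet (S : Σ n : ℕ, Finset (Fin n)) : List Bool :=
  List.ofFn fun i : Fin S.1 => decide (i ∈ S.2)

end EdgeMetric

/-! Edge metric generators are set covers: the ground set U consists of the pairs of different
edges, and a vertex covers the pairs that it distinguishes. Let k be the size of an optimal cover.
Some member of it covers at least a k-th part of whatever is still uncovered, so r greedy choices
leave at most |U| exp(-r/k) pairs. Before the last choice at least one pair was left, hence the
greedy cover has at most k log|U| + 1 elements (`uncovered_card_le`, `card_iterate_le`). Pairs are
stored as quadruples of ends, so |U| ≤ (2m)², and for m ≥ 2 the bound is at most 6 k log m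
(`card_greedy_le`).

The remaining work is to run this on an actual multi-stack machine. The greedy step is written as a
formula in a small logic over the graph that can count tuples of vertices and iterate an operator on
vertex sets. Counting compares gains; iteration produces the balls around a vertex, and two edges
are distinguished by v exactly when some ball around v meets one of them and not the other
(`eval_dist`). The greedy algorithm is the n-fold iteration of the operator defined by this formula
(`outputSet_greedy`).

Formulas compile to programs built from counted loops (`does_formula`). Loop lengths are the order
of the graph, values of variables or numbers of tuples, all polynomially bounded, so for a fixed
formula the cost is a polynomial (`Formula.isPoly_cost`). Counted-loop programs in turn compile to
machine code with an exactly known number of steps (`Prog.goes`, `computable_of_run`). -/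

/-! ## Counted-loop programs on stacks of bits, and their execution by multi-stack machines -/

namespace StackProgram

open Turing Function

/-- The basic operations on registers `r : R` that hold stacks of bits. -/
inductive Prim (R : Type)
  | push (r : R) (b : Bool)
  | pop (r : R)
  | move (r r' : R)
  | copy (r r' : R)
  | test (r r' : R)
  | nand (r : R)
  | tally (r r' : R)

/-- Programs: `rep r p` runs `p` as many times as there are leading `true`s on the stack `r`
when the loop is entered. -/
inductive Prog (R : Type)
  | prim (a : Prim R)
  | seq (p q : Prog R)
  | rep (r : R) (p : Prog R)

/-- The number of leading `true`s of a list of bits. -/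
def lead : List Bool → ℕ
  | true :: l => lead l + 1
  | _ => 0

@[simp] theorem lead_nil : lead [] = 0 := rfl
@[simp] theorem lead_true (l : List Bool) : lead (true :: l) = lead l + 1 := rfl
@[simp] theorem lead_false (l : List Bool) : lead (false :: l) = 0 := rfl

@[simp] theorem lead_replicate_append (m : ℕ) (l : List Bool) :
    lead (List.replicate m true ++ l) = m + lead l := by
  induction m with
  | zero => simp
  | succ m ih => simp [List.replicate_succ, ih]; omega

@[simp] theorem lead_replicate (m : ℕ) : lead (List.replicate m true) = m := by
  simpa using lead_replicate_append m []

theorem lead_decomp (l : List Bool) :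
    ∃ r, l = List.replicate (lead l) true ++ r ∧ r.head? ≠ some true := by
  induction l with
  | nil => exact ⟨[], by simp⟩
  | cons b l ih =>
    obtain ⟨r, h₁, h₂⟩ := ih
    cases b
    · exact ⟨false :: l, by simp⟩
    · exact ⟨r, by simpa [List.replicate_succ] using h₁, h₂⟩

section

variable {R : Type}

/-- The labels of the machine that executes a program. -/
def Label : Prog R → Type
  | .prim _ => Unit
  | .seq p q => Label p ⊕ Label q
  | .rep _ p => Fin 4 ⊕ Label p

instance Label.fintype : (p : Prog R) → Fintype (Label p)
  | .prim _ => inferInstanceAs (Fintype Unit)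
  | .seq p q =>
    letI := Label.fintype p
    letI := Label.fintype q
    inferInstanceAs (Fintype (Label p ⊕ Label q))
  | .rep _ p =>
    letI := Label.fintype p
    inferInstanceAs (Fintype (Fin 4 ⊕ Label p))

/-- The label at which the execution of a program begins. -/
def entry : (p : Prog R) → Label p
  | .prim _ => ()
  | .seq p _ => Sum.inl (entry p)
  | .rep _ _ => Sum.inl (0 : Fin 4)

/-- The stacks of the machine: the registers, a stack of loop counters and a temporary stack. -/
abbrev Stack (R : Type) : Type := R ⊕ Bool

/-- The statements of the machine. -/
abbrev MStmt (R Λ : Type) : Type := TM2.Stmt (fun _ : Stack R => Bool) Λ (Option Bool)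

open TM2.Stmt in
/-- The machine code of a basic operation, followed by the statement `q`. -/
def Prim.code {Λ : Type} : Prim R → MStmt R Λ → MStmt R Λ
  | .push r b, q => TM2.Stmt.push (Sum.inl r) (fun _ => b) q
  | .pop r, q => TM2.Stmt.pop (Sum.inl r) (fun _ o => o) q
  | .move r r', q => TM2.Stmt.pop (Sum.inl r) (fun _ o => o)
      (TM2.Stmt.push (Sum.inl r') (fun v => v.getD false) q)
  | .copy r r', q => peek (Sum.inl r) (fun _ o => o)
      (TM2.Stmt.push (Sum.inl r') (fun v => v.getD false) q)
  | .test r r', q => peek (Sum.inl r) (fun _ o => o)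
      (TM2.Stmt.push (Sum.inl r') (fun v => v.isSome) q)
  | .nand r, q => TM2.Stmt.pop (Sum.inl r) (fun _ o => o)
      (TM2.Stmt.pop (Sum.inl r) (fun v o => some (!(v.getD false && o.getD false)))
        (TM2.Stmt.push (Sum.inl r) (fun v => v.getD false) q))
  | .tally r r', q => TM2.Stmt.pop (Sum.inl r) (fun _ o => o)
      (branch (fun v => decide (v = some true))
        (TM2.Stmt.push (Sum.inl r') (fun _ => true) q) q)

open TM2.Stmt in
/-- The machine code of the control of a counted loop: mark the stack of loop counters, move the
leading `true`s of `r` to the temporary stack, move them back and to the stack of loop counters,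
and run the body, which begins at the label `body`, once for each of them. -/
def loopCode {Λ : Type} (r : R) (f : Fin 4 → Λ) (body next : Λ) : Fin 4 → MStmt R Λ
  | 0 => push (Sum.inr true) (fun _ => false) (goto fun _ => f 1)
  | 1 => peek (Sum.inl r) (fun _ o => o)
      (branch (fun v => decide (v = some true))
        (pop (Sum.inl r) (fun _ o => o)
          (push (Sum.inr false) (fun _ => true) (goto fun _ => f 1)))
        (goto fun _ => f 2))
  | 2 => pop (Sum.inr false) (fun _ o => o)
      (branch (fun v => decide (v = some true))
        (push (Sum.inl r) (fun _ => true)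
          (push (Sum.inr true) (fun _ => true) (goto fun _ => f 2)))
        (goto fun _ => f 3))
  | 3 => pop (Sum.inr true) (fun _ o => o)
      (branch (fun v => decide (v = some true)) (goto fun _ => body) (goto fun _ => next))

/-- The machine code of a program; `e` embeds its labels into those of the machine, and `next` is
the label where the execution continues. -/
def Prog.code {Λ : Type} : (p : Prog R) → (Label p → Λ) → Λ → Label p → MStmt R Λ
  | .prim a, _, next, _ => a.code (TM2.Stmt.goto fun _ => next)
  | .seq p q, e, next, l =>
    match l with
    | Sum.inl l => p.code (fun l => e (Sum.inl l)) (e (Sum.inr (entry q))) l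
    | Sum.inr l => q.code (fun l => e (Sum.inr l)) next l
  | .rep r p, e, next, l =>
    match l with
    | Sum.inl i => loopCode r (fun i => e (Sum.inl i)) (e (Sum.inr (entry p))) next i
    | Sum.inr l => p.code (fun l => e (Sum.inr l)) (e (Sum.inl (3 : Fin 4))) l

/-- The contents of the stacks of the machine, from the registers, the loop counters and the
temporary stack. -/
def stackVal (s : R → List Bool) (l t : List Bool) : (k : Stack R) → List Bool
  | Sum.inl r => s r
  | Sum.inr true => l
  | Sum.inr false => t

@[simp] theorem stackVal_inl (s : R → List Bool) (l t : List Bool) (r : R) :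
    stackVal s l t (Sum.inl r) = s r := rfl
@[simp] theorem stackVal_ctr (s : R → List Bool) (l t : List Bool) :
    stackVal s l t (Sum.inr true) = l := rfl
@[simp] theorem stackVal_tmp (s : R → List Bool) (l t : List Bool) :
    stackVal s l t (Sum.inr false) = t := rfl

variable [DecidableEq R]

/-- The effect of a basic operation on the registers. -/
def Prim.run : Prim R → (R → List Bool) → R → List Bool
  | push r b, s => update s r (b :: s r)
  | pop r, s => update s r (s r).tail
  | move r r', s =>
    let t := update s r (s r).tail
    update t r' ((s r).head?.getD false :: t r')
  | copy r r', s => update s r' ((s r).head?.getD false :: s r')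
  | test r r', s => update s r' ((s r).head?.isSome :: s r')
  | nand r, s => update s r ((!((s r).head?.getD false && (s r).tail.head?.getD false)) ::
      (s r).tail.tail)
  | tally r r', s =>
    let t := update s r (s r).tail
    if (s r).head? = some true then update t r' (true :: t r') else t

/-- The effect of a program on the registers. -/
def Prog.run : Prog R → (R → List Bool) → R → List Bool
  | prim a, s => a.run s
  | seq p q, s => q.run (p.run s)
  | rep r p, s => p.run^[lead (s r)] s

/-- The number of steps that a program takes on a machine. -/
def Prog.time : Prog R → (R → List Bool) → ℕ
  | prim _, _ => 1
  | seq p q, s => p.time s + q.time (p.run s)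
  | rep r p, s => 2 * lead (s r) + 4 + ∑ i ∈ Finset.range (lead (s r)), (p.time (p.run^[i] s) + 1)

@[simp] theorem update_stackVal_inl (s : R → List Bool) (l t : List Bool) (r : R) (x : List Bool) :
    update (stackVal s l t) (Sum.inl r) x = stackVal (update s r x) l t := by
  ext1 k
  rcases k with k | (_ | _)
  · by_cases h : k = r
    · subst h; simp
    · rw [update_of_ne (by simpa using h)]; simp [h]
  · simp
  · simp

@[simp] theorem update_stackVal_ctr (s : R → List Bool) (l t x : List Bool) :
    update (stackVal s l t) (Sum.inr true) x = stackVal s x t := by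
  ext1 k
  rcases k with k | (_ | _) <;> simp

@[simp] theorem update_stackVal_tmp (s : R → List Bool) (l t x : List Bool) :
    update (stackVal s l t) (Sum.inr false) x = stackVal s l x := by
  ext1 k
  rcases k with k | (_ | _) <;> simp

/-- The machine with code `m` goes in `t` steps from label `a` with stacks `S` to label `b` with
stackVal `S'`, whatever its internal state at the beginning. -/
def Goes {Λ : Type} (m : Λ → MStmt R Λ) (a : Λ) (S : Stack R → List Bool) (t : ℕ) (b : Λ)
    (S' : Stack R → List Bool) : Prop :=
  ∀ v, ∃ v', (flip bind (TM2.step m))^[t] (some ⟨some a, v, S⟩) = some ⟨some b, v', S'⟩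

theorem Goes.trans {Λ : Type} {m : Λ → MStmt R Λ} {a b c : Λ} {S S' S'' : Stack R → List Bool}
    {t t' : ℕ} (h : Goes m a S t b S') (h' : Goes m b S' t' c S'') : Goes m a S (t + t') c S'' := by
  intro v
  obtain ⟨v', hv'⟩ := h v
  obtain ⟨v'', hv''⟩ := h' v'
  exact ⟨v'', by rw [add_comm, iterate_add_apply, hv', hv'']⟩

theorem Goes.single {Λ : Type} {m : Λ → MStmt R Λ} {a b : Λ} {S S' : Stack R → List Bool}
    (h : ∀ v, ∃ v', TM2.stepAux (m a) v S = ⟨some b, v', S'⟩) : Goes m a S 1 b S' := by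
  intro v
  obtain ⟨v', hv'⟩ := h v
  exact ⟨v', by simp [flip, TM2.step, hv']⟩

/-- The code of a basic operation contains no jump, so together with the `goto` that follows it
makes a single machine step. Whatever it uses of the internal state it has read itself, which is why
the initial `v` does not matter. -/
theorem Prim.stepAux_code {Λ : Type} (a : Prim R) (q : MStmt R Λ) (s : R → List Bool)
    (l t : List Bool) (v : Option Bool) :
    ∃ v', TM2.stepAux (a.code q) v (stackVal s l t) = TM2.stepAux q v' (stackVal (a.run s) l t) := by
  cases a <;> simp only [Prim.code, TM2.stepAux, update_stackVal_inl, stackVal_inl, Prim.run]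
  case nand r => exact ⟨_, by simp; rfl⟩
  case tally r r' =>
    by_cases h : (s r).head? = some true
    · exact ⟨some true, by simp [h]⟩
    · exact ⟨_, by simp [h]; rfl⟩
  all_goals exact ⟨_, rfl⟩

/-- The four facts below are the four phases of `loopCode`. The `false` pushed first marks the
bottom of this loop's counter, so counters of nested loops pile up on one stack; hence `hp` is
required for every `l`. The temporary stack is empty again before the body starts, so nested loops
can share it. -/
theorem Goes.loop {Λ : Type} {m : Λ → MStmt R Λ} {r : R} {p : Prog R} {f : Fin 4 → Λ}
    {body next : Λ} (hf : ∀ i, m (f i) = loopCode r f body next i)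
    (hp : ∀ s l, Goes m body (stackVal s l []) (p.time s) (f 3) (stackVal (p.run s) l []))
    (s : R → List Bool) (l : List Bool) :
    Goes m (f 0) (stackVal s l []) ((Prog.rep r p).time s) next
      (stackVal ((Prog.rep r p).run s) l []) := by
  have first : ∀ s l, Goes m (f 0) (stackVal s l []) 1 (f 1) (stackVal s (false :: l) []) := by
    intro s l
    refine Goes.single fun v => ⟨v, ?_⟩
    simp [hf, loopCode]
  have second : ∀ (x : List Bool), x.head? ≠ some true → ∀ (k : ℕ) (l t : List Bool),
      Goes m (f 1) (stackVal (update s r (List.replicate k true ++ x)) l t)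
        (k + 1) (f 2) (stackVal (update s r x) l (List.replicate k true ++ t)) := by
    intro x hx k
    induction k with
    | zero =>
      intro l t
      refine Goes.single fun v => ⟨x.head?, ?_⟩
      simp [hf, loopCode, hx]
    | succ k ihk =>
      intro l t
      have h : Goes m (f 1)
          (stackVal (update s r (List.replicate (k + 1) true ++ x)) l t) 1
          (f 1) (stackVal (update s r (List.replicate k true ++ x)) l (true :: t)) := by
        refine Goes.single fun v => ⟨some true, ?_⟩
        simp [hf, loopCode, List.replicate_succ]
      have h' := h.trans (ihk l (true :: t))
      rwa [add_comm 1, List.append_cons (List.replicate k true), ← List.replicate_succ'] at h'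
  have third : ∀ (k : ℕ) (x l : List Bool),
      Goes m (f 2) (stackVal (update s r x) l (List.replicate k true)) (k + 1) (f 3)
        (stackVal (update s r (List.replicate k true ++ x)) (List.replicate k true ++ l) []) := by
    intro k
    induction k with
    | zero =>
      intro x l
      refine Goes.single fun v => ⟨none, ?_⟩
      simp [hf, loopCode]
    | succ k ihk =>
      intro x l
      have h : Goes m (f 2) (stackVal (update s r x) l (List.replicate (k + 1) true)) 1
          (f 2) (stackVal (update s r (true :: x)) (true :: l) (List.replicate k true)) := by
        refine Goes.single fun v => ⟨some true, ?_⟩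
        simp [hf, loopCode, List.replicate_succ]
      have h' := h.trans (ihk (true :: x) (true :: l))
      rwa [add_comm 1, List.append_cons (List.replicate k true) true x,
        List.append_cons (List.replicate k true) true l, ← List.replicate_succ'] at h'
  have fourth : ∀ (k : ℕ) (s : R → List Bool) (l : List Bool),
      Goes m (f 3) (stackVal s (List.replicate k true ++ false :: l) [])
        (1 + ∑ i ∈ Finset.range k, (p.time (p.run^[i] s) + 1)) next
        (stackVal (p.run^[k] s) l []) := by
    intro k
    induction k with
    | zero =>
      intro s l
      refine Goes.single fun v => ⟨some false, ?_⟩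
      simp [hf, loopCode]
    | succ k ihk =>
      intro s l
      have h : Goes m (f 3) (stackVal s (List.replicate (k + 1) true ++ false :: l) []) 1
          body (stackVal s (List.replicate k true ++ false :: l) []) := by
        refine Goes.single fun v => ⟨some true, ?_⟩
        simp [hf, loopCode, List.replicate_succ]
      have h' := (h.trans (hp _ _)).trans (ihk _ _)
      -- The first pass is split off the sum, since the induction continues from the registers after
      -- one pass.
      rw [Finset.sum_range_succ']
      simp only [iterate_succ_apply, iterate_zero_apply]
      convert h' using 1
      omega
  -- The remainder `x` does not begin with `true`, which is what stops the second phase.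
  obtain ⟨x, hx, hx'⟩ := lead_decomp (s r)
  have h₂ := second x hx' (lead (s r)) (false :: l) []
  have h₃ := third (lead (s r)) x (false :: l)
  rw [← hx, update_eq_self, List.append_nil] at h₂
  rw [← hx, update_eq_self] at h₃
  have h' := (((first s l).trans h₂).trans h₃).trans (fourth (lead (s r)) s l)
  rw [Prog.run, Prog.time]
  convert h' using 1
  omega

/-- Executing a program on a machine that contains its code. -/
theorem Prog.goes {Λ : Type} (m : Λ → MStmt R Λ) (p : Prog R) :
    ∀ (e : Label p → Λ) (next : Λ), (∀ l, m (e l) = p.code e next l) →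
      ∀ (s : R → List Bool) (l : List Bool),
        Goes m (e (entry p)) (stackVal s l []) (p.time s) next (stackVal (p.run s) l []) := by
  induction p with
  | prim a =>
    intro e next he s l
    refine Goes.single fun v => ?_
    rw [he]
    obtain ⟨v', hv'⟩ := Prim.stepAux_code a (TM2.Stmt.goto fun _ => next) s l [] v
    exact ⟨v', hv'⟩
  | seq p q ihp ihq =>
    intro e next he s l
    exact (ihp (fun l => e (Sum.inl l)) _ (fun l => he (Sum.inl l)) s l).trans
      (ihq (fun l => e (Sum.inr l)) _ (fun l => he (Sum.inr l)) _ l)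
  | rep r p ih =>
    intro e next he s l
    exact Goes.loop (f := fun i => e (Sum.inl i)) (fun i => he (Sum.inl i))
      (ih (fun l => e (Sum.inr l)) _ (fun l => he (Sum.inr l))) s l

/-- The machine that executes a program, with the given input and output registers. -/
def machine [Fintype R] (p : Prog R) (input output : R) : FinTM2 where
  K := Stack R
  k₀ := Sum.inl input
  k₁ := Sum.inl output
  Γ _ := Bool
  Λ := Option (Label p)
  main := some (entry p)
  σ := Option Bool
  initialState := none
  Γk₀Fin := inferInstanceAs (Fintype Bool)
  m l := match l with
    -- `haltList` demands the initial internal state, so the state left by the program is erased;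
    -- this is the one extra step in the time bound.
    | none => TM2.Stmt.load (fun _ => none) TM2.Stmt.halt
    | some l => p.code some none l

/-- A program that takes the encoding of `a` in the input register to that of `f a` in the output
register, in polynomial time, gives a polynomial-time machine for `f`. -/
theorem computable_of_run [Fintype R] {α β : Type} (ea : α → List Bool) (eb : β → List Bool)
    (f : α → β) (p : Prog R) (input output : R) (P : Polynomial ℕ)
    (h : ∀ a, p.run (update (fun _ => []) input (ea a)) = update (fun _ => []) output (eb (f a)))
    (ht : ∀ a, p.time (update (fun _ => []) input (ea a)) + 1 ≤ P.eval (ea a).length) :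
    Nonempty (TM2ComputableInPolyTime ea eb f) := by
  have key : ∀ a, (flip bind (machine p input output).step)^[
      p.time (update (fun _ => []) input (ea a)) + 1]
      (some (initList (machine p input output) (ea a))) =
      some (haltList (machine p input output) (eb (f a))) := by
    intro a
    obtain ⟨v, hv⟩ := Prog.goes (machine p input output).m p some none (fun _ => rfl)
      (update (fun _ => []) input (ea a)) [] none
    have h₀ : initList (machine p input output) (ea a) =
        ⟨some (some (entry p)), none, stackVal (update (fun _ => []) input (ea a)) [] []⟩ := by
      unfold initList
      congr 1
      funext k
      rcases k with k | (_ | _)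
      · by_cases hk : k = input
        · subst hk
          exact (dif_pos rfl).trans (by rw [stackVal_inl, update_self]; rfl)
        · have hk' : ¬ (Sum.inl k : Stack R) = Sum.inl input := by simpa using hk
          exact (dif_neg hk').trans (by rw [stackVal_inl, update_of_ne hk]; rfl)
      · rfl
      · rfl
    have h₁ : haltList (machine p input output) (eb (f a)) =
        ⟨none, none, stackVal (update (fun _ => []) output (eb (f a))) [] []⟩ := by
      unfold haltList
      congr 1
      funext k
      rcases k with k | (_ | _)
      · by_cases hk : k = output
        · subst hk
          exact (dif_pos rfl).trans (by rw [stackVal_inl, update_self]; rfl)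
        · have hk' : ¬ (Sum.inl k : Stack R) = Sum.inl output := by simpa using hk
          exact (dif_neg hk').trans (by rw [stackVal_inl, update_of_ne hk]; rfl)
      · rfl
      · rfl
    rw [h₀, h₁, ← h a, iterate_succ_apply']
    refine (congrArg (flip bind (machine p input output).step) hv).trans ?_
    rfl
  exact ⟨{ tm := machine p input output
           inputAlphabet := Equiv.refl Bool
           outputAlphabet := Equiv.refl Bool
           time := P
           outputsFun := fun a =>
             { steps := _
               evals_in_steps := by
                 have hi : ∀ x : List Bool, List.map (Equiv.refl Bool).invFun x = x := fun x =>
                   List.map_id x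
                 have := key a
                 rw [← hi (ea a), ← hi (eb (f a))] at this
                 exact this
               steps_le_m := by
                 have := ht a
                 simpa using this } }⟩

end

end StackProgram

/-! ## Formulas over finite graphs with counting and iteration, and programs that evaluate them -/

namespace StackProgram

open Function

section

variable {R : Type} [DecidableEq R]

/-- The program `p` takes `s` to `s'` in at most `T` steps. -/
def Does (p : Prog R) (s s' : R → List Bool) (T : ℕ) : Prop :=
  p.run s = s' ∧ p.time s ≤ T

theorem Does.mono {p : Prog R} {s s' : R → List Bool} {T T' : ℕ} (h : Does p s s' T)
    (hT : T ≤ T') : Does p s s' T' := ⟨h.1, h.2.trans hT⟩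

theorem does_of_prim {a : Prim R} {s s' : R → List Bool} (h : a.run s = s') :
    Does (.prim a) s s' 1 := ⟨h, le_rfl⟩

theorem does_seq {p q : Prog R} {s s' s'' : R → List Bool} {T T' : ℕ} (h : Does p s s' T)
    (h' : Does q s' s'' T') : Does (.seq p q) s s'' (T + T') := by
  obtain ⟨rfl, hT⟩ := h
  exact ⟨h'.1, add_le_add hT h'.2⟩

/-- Loop rule with the states `F i` as invariant. The number of passes is fixed on entry, so the
body may change `r`. Each pass costs the body, one control step, and two steps for moving its
counter bit. -/
theorem does_rep {r : R} {p : Prog R} (F : ℕ → R → List Bool) {m T : ℕ} (hm : lead (F 0 r) = m)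
    (h : ∀ i < m, Does p (F i) (F (i + 1)) T) :
    Does (.rep r p) (F 0) (F m) (m * (T + 3) + 4) := by
  have key : ∀ i ≤ m, p.run^[i] (F 0) = F i := by
    intro i
    induction i with
    | zero => intro _; rfl
    | succ i ih =>
      intro hi
      rw [iterate_succ_apply', ih (by omega)]
      exact (h i (by omega)).1
  subst hm
  refine ⟨key _ le_rfl, ?_⟩
  rw [Prog.time]
  have : ∑ i ∈ Finset.range (lead (F 0 r)), (p.time (p.run^[i] (F 0)) + 1) ≤
      ∑ i ∈ Finset.range (lead (F 0 r)), (T + 1) := by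
    refine Finset.sum_le_sum fun i hi => ?_
    have hi := Finset.mem_range.1 hi
    rw [key i hi.le]
    exact Nat.succ_le_succ (h i hi).2
  rw [Finset.sum_const, Finset.card_range, smul_eq_mul] at this
  nlinarith

/-- The case `a = r` is included and is how a unary number is erased. -/
theorem does_popMany {r : R} (a : R) {s : R → List Bool} {k : ℕ} (hk : lead (s r) = k) :
    Does (.rep r (.prim (.pop a))) s (update s a ((s a).drop k)) (k * 4 + 4) := by
  have h := does_rep (r := r) (p := .prim (.pop a)) (fun i => update s a ((s a).drop i))
    (m := k) (T := 1) (by simpa using hk)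
    (fun i _ => does_of_prim (by simp [Prim.run]))
  simpa using h

theorem does_pushMany {r : R} (a : R) (b : Bool) {s : R → List Bool} {k : ℕ}
    (hk : lead (s r) = k) :
    Does (.rep r (.prim (.push a b))) s (update s a (List.replicate k b ++ s a)) (k * 4 + 4) := by
  have h := does_rep (r := r) (p := .prim (.push a b))
    (fun i => update s a (List.replicate i b ++ s a))
    (m := k) (T := 1) (by simpa using hk)
    (fun i _ => does_of_prim (by simp [Prim.run, List.replicate_succ]))
  simpa using h

theorem Prim.run_move {a b : R} (hab : a ≠ b) (s : R → List Bool) {x : Bool} {l : List Bool}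
    (h : s a = x :: l) :
    (Prim.move a b).run s = update (update s a l) b (x :: s b) := by
  simp [Prim.run, h, hab.symm]

theorem does_moveMany {r a b : R} (hab : a ≠ b) {s : R → List Bool} {k : ℕ}
    (hk : lead (s r) = k) (hl : k ≤ (s a).length) :
    Does (.rep r (.prim (.move a b))) s
      (update (update s a ((s a).drop k)) b (((s a).take k).reverse ++ s b)) (k * 4 + 4) := by
  have h := does_rep (r := r) (p := .prim (.move a b))
    (fun i => update (update s a ((s a).drop i)) b (((s a).take i).reverse ++ s b))
    (m := k) (T := 1) (by simpa using hk)
    (fun i hi => does_of_prim (by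
      have hi' : i < (s a).length := by omega
      rw [Prim.run_move hab (x := (s a)[i]) (l := (s a).drop (i + 1))]
      · funext c
        by_cases hb : c = b
        · subst hb
          have e : ((s a).take (i + 1)).reverse = (s a)[i] :: ((s a).take i).reverse := by
            rw [List.take_add_one, List.getElem?_eq_getElem hi', Option.toList_some,
              List.reverse_append]
            rfl
          simp [e]
        · by_cases ha : c = a
          · subst ha; simp [hab]
          · simp [ha, hb]
      · rw [update_of_ne hab, update_self, List.drop_eq_getElem_cons hi']))
  simpa using h

theorem does_moveBlocks {r q a b : R} (hab : a ≠ b) (hra : q ≠ a) (hrb : q ≠ b)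
    {s : R → List Bool} {k n : ℕ}
    (hk : lead (s r) = k) (hn : lead (s q) = n) (hl : k * n ≤ (s a).length) :
    Does (.rep r (.rep q (.prim (.move a b)))) s
      (update (update s a ((s a).drop (k * n))) b (((s a).take (k * n)).reverse ++ s b))
      (k * (n * 4 + 7) + 4) := by
  have h := does_rep (r := r) (p := .rep q (.prim (.move a b)))
    (fun i => update (update s a ((s a).drop (i * n))) b (((s a).take (i * n)).reverse ++ s b))
    (m := k) (T := n * 4 + 4) (by simpa using hk)
    (fun i hi => by
      have hi' : (i + 1) * n ≤ k * n := Nat.mul_le_mul_right n hi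
      have hq : lead ((update (update s a ((s a).drop (i * n))) b
        (((s a).take (i * n)).reverse ++ s b)) q) = n := by simpa [hra, hrb] using hn
      have := does_moveMany hab hq (by
        rw [update_of_ne hab, update_self, List.length_drop]
        rw [add_mul, one_mul] at hi'
        omega)
      convert this using 1
      funext c
      by_cases hb : c = b
      · subst hb
        simp [hab, add_mul, List.take_add]
      · by_cases ha : c = a
        · subst ha; simp [hab, add_mul]
        · simp [ha, hb])
  simpa using h

end

/-- The variables of formulas: for vertices, and for numbers. -/
inductive Var
  | vtx (i : Fin 11)
  | num (i : Fin 2)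
  deriving DecidableEq, Fintype

/-- The registers: the adjacency matrix, the number of vertices in unary, an accumulator for the
values of formulas, an auxiliary stack for the access to arrays, an auxiliary counter, the
variables, and sets of vertices. -/
inductive Reg
  | mat
  | size
  | acc
  | shift
  | cnt
  | var (x : Var)
  | set (i : Fin 2)
  deriving DecidableEq, Fintype

open Var Reg Prim Prog

/-- An environment: a graph on the numbers below `n`, with the values of the variables. -/
structure Env where
  n : ℕ
  adj : ℕ → ℕ → Bool
  val : Var → ℕ
  sets : Fin 2 → ℕ → Bool

/-- Assign a value to a variable. -/
def Env.setVal (E : Env) (x : Var) (i : ℕ) : Env := { E with val := update E.val x i }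

/-- Assign a value to a set variable. -/
def Env.setSet (E : Env) (A : Fin 2) (f : ℕ → Bool) : Env := { E with sets := update E.sets A f }

/-- The number of values of the variables in a list for which `f` holds. -/
def Env.tally (f : Env → Bool) : List (Fin 11) → Env → ℕ
  | [], E => (f E).toNat
  | x :: xs, E => ∑ i ∈ Finset.range E.n, Env.tally f xs (E.setVal (vtx x) i)

/-- This keeps the numbers produced by `count`, and with them the loops that they control,
polynomial in the order. -/
theorem Env.tally_le (f : Env → Bool) (xs : List (Fin 11)) (E : Env) :
    E.tally f xs ≤ E.n ^ xs.length := by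
  induction xs generalizing E with
  | nil => simpa [tally] using Bool.toNat_le (f E)
  | cons x xs ih =>
    calc E.tally f (x :: xs) ≤ ∑ i ∈ Finset.range E.n, E.n ^ xs.length :=
          Finset.sum_le_sum fun i _ => ih (E.setVal (vtx x) i)
      _ = E.n ^ (x :: xs).length := by simp [pow_succ']

/-- Formulas. The formula `count c xs φ e` is `e`, where `c` is the number of values of the
variables `xs` for which `φ` holds; the formula `iter A k x φ e` is `e`, where `A` is the set
obtained from the empty set by applying `k` times the operator that takes `A` to `{x | φ}`. -/
inductive Formula
  | adj (x y : Fin 11)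
  | lt (x y : Var)
  | mem (A : Fin 2) (x : Fin 11)
  | nand (φ ψ : Formula)
  | count (c : Fin 2) (xs : List (Fin 11)) (φ e : Formula)
  | iter (A : Fin 2) (k : Var) (x : Fin 11) (φ e : Formula)

/-- The truth value of a formula. -/
def Formula.eval : Formula → Env → Bool
  | adj x y, E => E.adj (E.val (vtx x)) (E.val (vtx y))
  | lt x y, E => decide (E.val x < E.val y)
  | mem A x, E => E.sets A (E.val (vtx x))
  | nand φ ψ, E => !(φ.eval E && ψ.eval E)
  | count c xs φ e, E => e.eval (E.setVal (num c) (E.tally φ.eval xs))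
  | iter A k x φ e, E => e.eval (E.setSet A
      ((fun f i => φ.eval ((E.setSet A f).setVal (vtx x) i))^[E.val k] fun _ => false))

/-- Run a program for all values of a vertex variable. -/
def forEach (x : Fin 11) (p : Prog Reg) : Prog Reg :=
  seq (prim (push (var (vtx x)) false))
    (seq (rep size (seq p (prim (push (var (vtx x)) true))))
      (seq (rep (var (vtx x)) (prim (pop (var (vtx x))))) (prim (pop (var (vtx x))))))

/-- Run a program for all values of a list of vertex variables. -/
def forAll : List (Fin 11) → Prog Reg → Prog Reg
  | [], p => p
  | x :: xs, p => forEach x (forAll xs p)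

/-- Replace the set `A` by the set of the values of `x` for which the program `p` gives `true`. -/
def replaceSet (A : Fin 2) (x : Fin 11) (p : Prog Reg) : Prog Reg :=
  seq (forEach x p) (seq (rep size (prim (pop (set A)))) (rep size (prim (move acc (set A)))))

/-- The program that evaluates a formula and pushes its value on the accumulator. -/
def Formula.prog : Formula → Prog Reg
  | adj x y =>
    seq (seq (rep (var (vtx x)) (rep size (prim (move mat shift))))
        (rep (var (vtx y)) (prim (move mat shift))))
      (seq (prim (copy mat acc))
        (seq (rep (var (vtx y)) (prim (move shift mat)))
          (rep (var (vtx x)) (rep size (prim (move shift mat))))))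
  | lt x y =>
    seq (rep (var y) (prim (push shift true)))
      (seq (rep (var x) (prim (pop shift)))
        (seq (prim (test shift acc)) (rep shift (prim (pop shift)))))
  | mem A x =>
    seq (rep (var (vtx x)) (prim (move (set A) shift)))
      (seq (prim (copy (set A) acc)) (rep (var (vtx x)) (prim (move shift (set A)))))
  | nand φ ψ => seq φ.prog (seq ψ.prog (prim (Prim.nand acc)))
  | count c xs φ e =>
    seq (prim (push cnt false))
      (seq (forAll xs (seq φ.prog (prim (tally acc cnt))))
        (seq (prim (push (var (num c)) false))
          (seq (rep cnt (prim (push (var (num c)) true)))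
            (seq (rep cnt (prim (pop cnt)))
              (seq (prim (pop cnt))
                (seq e.prog
                  (seq (rep (var (num c)) (prim (pop (var (num c)))))
                    (prim (pop (var (num c)))))))))))
  | iter A k x φ e =>
    seq (rep size (prim (push (set A) false)))
      (seq (rep (var k) (replaceSet A x φ.prog))
        (seq e.prog (rep size (prim (pop (set A))))))

/-- The time of a loop over all vertices. -/
def forCost (B T : ℕ) : ℕ := B * (T + 8) + 10

/-- The time of nested loops over all vertices. -/
def forAllCost (B T : ℕ) : ℕ → ℕ
  | 0 => T
  | k + 1 => forCost B (forAllCost B T k)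

/-- The time of the evaluation of a formula, where `B` bounds the number of vertices and the values
of the variables. -/
def Formula.cost : Formula → ℕ → ℕ
  | adj _ _, B => ((B * (B * 4 + 7) + 4) + (B * 4 + 4)) + (1 + ((B * 4 + 4) + (B * (B * 4 + 7) + 4)))
  | lt _ _, B => (B * 4 + 4) + ((B * 4 + 4) + (1 + (B * 4 + 4)))
  | mem _ _, B => (B * 4 + 4) + (1 + (B * 4 + 4))
  | nand φ ψ, B => φ.cost B + (ψ.cost B + 1)
  | count _ xs φ e, B =>
    1 + (forAllCost B (φ.cost B + 1) xs.length + (1 + ((B ^ xs.length * 4 + 4) +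
      ((B ^ xs.length * 4 + 4) + (1 + (e.cost (B + B ^ xs.length) +
        ((B ^ xs.length * 4 + 4) + 1)))))))
  | iter _ _ _ φ e, B =>
    (B * 4 + 4) + ((B * (forCost B (φ.cost B) + ((B * 4 + 4) + (B * 4 + 4)) + 3) + 4) +
      (e.cost B + (B * 4 + 4)))

/-- The registers hold the values of the environment, which are bounded by `B`. -/
structure Holds (B : ℕ) (E : Env) (s : Reg → List Bool) : Prop where
  size : s size = List.replicate E.n true
  shift : s shift = []
  mat : ∀ i < E.n, ∀ j < E.n, (s mat)[i * E.n + j]? = some (E.adj i j)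
  val : ∀ x, lead (s (var x)) = E.val x
  lt : ∀ i, E.val (vtx i) < E.n
  set : ∀ A, ∀ i < E.n, (s (set A))[i]? = some (E.sets A i)
  le : E.n ≤ B
  val_le : ∀ x, E.val x ≤ B

namespace Holds

variable {B : ℕ} {E : Env} {s : Reg → List Bool}

theorem lead_size (h : Holds B E s) : lead (s Reg.size) = E.n := by simp [h.size]

theorem update_acc (h : Holds B E s) (l : List Bool) : Holds B E (update s acc l) :=
  ⟨h.size, h.shift, h.mat, h.val, h.lt, h.set, h.le, h.val_le⟩

theorem update_cnt (h : Holds B E s) (l : List Bool) : Holds B E (update s cnt l) :=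
  ⟨h.size, h.shift, h.mat, h.val, h.lt, h.set, h.le, h.val_le⟩

theorem update_var (h : Holds B E s) (x : Fin 11) {i : ℕ} (hi : i < E.n) {l : List Bool}
    (hl : lead l = i) : Holds B (E.setVal (vtx x) i) (update s (var (vtx x)) l) where
  size := h.size
  shift := h.shift
  mat := h.mat
  val y := by
    by_cases hy : y = vtx x
    · subst hy; simp [Env.setVal, hl]
    · simpa [Env.setVal, hy] using h.val y
  lt j := by
    by_cases hj : j = x
    · subst hj; simpa [Env.setVal] using hi
    · simpa [Env.setVal, hj] using h.lt j
  set := h.set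
  le := h.le
  val_le y := by
    by_cases hy : y = vtx x
    · subst hy; simpa [Env.setVal] using hi.le.trans h.le
    · simpa [Env.setVal, hy] using h.val_le y

/-- Unlike a vertex, a count may exceed the current bound, so `B` is allowed to grow. -/
theorem update_num (h : Holds B E s) (c : Fin 2) {i B' : ℕ} {l : List Bool} (hB : B ≤ B')
    (hi : i ≤ B') (hl : lead l = i) : Holds B' (E.setVal (num c) i) (update s (var (num c)) l) where
  size := h.size
  shift := h.shift
  mat := h.mat
  val y := by
    by_cases hy : y = num c
    · subst hy; simp [Env.setVal, hl]
    · simpa [Env.setVal, hy] using h.val y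
  lt j := by simpa [Env.setVal] using h.lt j
  set := h.set
  le := h.le.trans hB
  val_le y := by
    by_cases hy : y = num c
    · subst hy; simpa [Env.setVal] using hi
    · simpa [Env.setVal, hy] using (h.val_le y).trans hB

theorem update_set (h : Holds B E s) (A : Fin 2) {f : ℕ → Bool} {l : List Bool}
    (hl : ∀ i < E.n, l[i]? = some (f i)) : Holds B (E.setSet A f) (update s (Reg.set A) l) where
  size := h.size
  shift := h.shift
  mat := h.mat
  val := h.val
  lt := h.lt
  set A' i hi := by
    by_cases hA : A' = A
    · subst hA; simpa [Env.setSet] using hl i hi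
    · simpa [Env.setSet, hA] using h.set A' i hi
  le := h.le
  val_le := h.val_le

end Holds

/-- The loop value is kept in unary on top of a `false`, with the previous value `r` of the variable
untouched below it, so popping restores the enclosing scope. `G i` describes the registers after `i`
rounds, apart from this local value. -/
theorem does_forEach {x : Fin 11} {p : Prog Reg} (G : ℕ → Reg → List Bool) {n T : ℕ}
    {r : List Bool} (hn : lead (G 0 size) = n) (hx : ∀ i, G i (var (vtx x)) = r)
    (h : ∀ i < n, Does p (update (G i) (var (vtx x)) (List.replicate i true ++ false :: r))
      (update (G (i + 1)) (var (vtx x)) (List.replicate i true ++ false :: r)) T) :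
    Does (forEach x p) (G 0) (G n) (forCost n T) := by
  have h₁ : Does (prim (push (var (vtx x)) false)) (G 0)
      (update (G 0) (var (vtx x)) (List.replicate 0 true ++ false :: r)) 1 :=
    does_of_prim (by simp [Prim.run, hx])
  have h₂ := does_rep (r := size) (p := seq p (prim (push (var (vtx x)) true)))
    (fun i => update (G i) (var (vtx x)) (List.replicate i true ++ false :: r))
    (m := n) (T := T + 1) (by simpa using hn)
    (fun i hi => does_seq (h i hi) (does_of_prim (by simp [Prim.run, List.replicate_succ])))
  have h₃ := does_popMany (r := var (vtx x)) (var (vtx x)) (k := n)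
    (s := update (G n) (var (vtx x)) (List.replicate n true ++ false :: r)) (by simp)
  have h₄ : Does (prim (pop (var (vtx x)))) (update (G n) (var (vtx x)) (false :: r)) (G n) 1 :=
    does_of_prim (by simp [Prim.run, ← hx n])
  simp only [update_self, update_idem, List.drop_left' (List.length_replicate ..)] at h₃
  exact (does_seq h₁ (does_seq h₂ (does_seq h₃ h₄))).mono (by unfold forCost; nlinarith)

theorem forCost_mono {n B T : ℕ} (h : n ≤ B) : forCost n T ≤ forCost B T := by
  unfold forCost; gcongr

theorem does_forAll {p : Prog Reg} {f : Env → Bool} {B T : ℕ}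
    (hp : ∀ E s, Holds B E s →
      Does p s (update s cnt (List.replicate (f E).toNat true ++ s cnt)) T) (xs : List (Fin 11)) :
    ∀ E s, Holds B E s → Does (forAll xs p) s
      (update s cnt (List.replicate (E.tally f xs) true ++ s cnt)) (forAllCost B T xs.length) := by
  induction xs with
  | nil => exact hp
  | cons x xs ih =>
    intro E s hs
    have h := does_forEach (x := x) (p := StackProgram.forAll xs p)
      (fun i => update s cnt (List.replicate
        (∑ j ∈ Finset.range i, (E.setVal (vtx x) j).tally f xs) true ++ s cnt))
      (n := E.n) (r := s (var (vtx x))) (T := forAllCost B T xs.length)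
      (by simpa using hs.lead_size) (by simp)
      (fun i hi => by
        have := ih (E.setVal (vtx x) i) (update (update s cnt (List.replicate
          (∑ j ∈ Finset.range i, (E.setVal (vtx x) j).tally f xs) true ++ s cnt)) (var (vtx x))
          (List.replicate i true ++ false :: s (var (vtx x))))
          ((hs.update_cnt _).update_var x hi (by simp))
        convert this using 1
        funext c
        by_cases hc : c = cnt
        · subst hc
          simp [Finset.sum_range_succ, ← List.append_assoc, List.replicate_append_replicate,
            add_comm]
        · by_cases hv : c = var (vtx x)
          · subst hv; simp
          · simp [hc, hv])
    have h' := h.mono (forCost_mono hs.le)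
    simp only [Finset.range_zero, Finset.sum_empty, List.replicate_zero, List.nil_append,
      update_eq_self] at h'
    exact h'

end StackProgram

/-! ### Correctness and running time of the compiled formulas. -/

namespace StackProgram

open Function
open Var Reg Prim Prog

theorem update_update_update {α : Type} {β : Type} [DecidableEq α] {a b : α} (hab : a ≠ b)
    (f : α → β) (x y z : β) :
    update (update (update f a x) b y) a z = update (update f a z) b y := by
  rw [update_comm hab.symm, update_idem]

/-- The bits of a set of numbers below `n`. -/
def bits (f : ℕ → Bool) (n : ℕ) : List Bool := (List.range n).map f

@[simp] theorem length_bits (f : ℕ → Bool) (n : ℕ) : (bits f n).length = n := by simp [bits]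

theorem bits_false (n : ℕ) : bits (fun _ => false) n = List.replicate n false := by
  simp [bits, List.map_const']

theorem getElem?_bits_append {f : ℕ → Bool} {n i : ℕ} (hi : i < n) (l : List Bool) :
    (bits f n ++ l)[i]? = some (f i) := by
  rw [List.getElem?_append_left (by simpa using hi)]
  simp [bits, hi]

/-- All new bits are collected on the accumulator before the old set is popped, so every evaluation
sees the old set. They are stacked in reverse, and moving them to `A` reverses them back. -/
theorem does_replaceSet {A : Fin 2} {x : Fin 11} {p : Prog Reg} {s : Reg → List Bool} {n T : ℕ}
    {g : ℕ → Bool} {b r : List Bool} (hn : lead (s size) = n) (hA : s (set A) = b ++ r)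
    (hb : b.length = n)
    (hp : ∀ i < n, ∀ l, Does p
      (update (update s acc l) (var (vtx x)) (List.replicate i true ++ false :: s (var (vtx x))))
      (update (update s acc (g i :: l)) (var (vtx x))
        (List.replicate i true ++ false :: s (var (vtx x)))) T) :
    Does (replaceSet A x p) s (update s (set A) (bits g n ++ r))
      (forCost n T + ((n * 4 + 4) + (n * 4 + 4))) := by
  have h₁ := does_forEach (x := x) (p := p)
    (fun i => update s acc ((bits g i).reverse ++ s acc)) (n := n) (T := T)
    (r := s (var (vtx x))) (by simpa using hn) (by simp)
    (fun i hi => by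
      have := hp i hi ((bits g i).reverse ++ s acc)
      simpa [bits, List.range_succ] using this)
  have h₂ := does_popMany (r := size) (set A) (k := n)
    (s := update s acc ((bits g n).reverse ++ s acc)) (by simpa using hn)
  have h₃ := does_moveMany (r := size) (a := acc) (b := set A) (by simp) (k := n)
    (s := update (update s acc ((bits g n).reverse ++ s acc)) (set A) r) (by simpa using hn)
    (by simp)
  simp only [ne_eq, reduceCtorEq, not_false_eq_true, update_of_ne, hA,
    List.drop_left' hb] at h₂
  have h := does_seq h₁ (does_seq h₂ h₃)
  have e₀ : update s acc ((bits g 0).reverse ++ s acc) = s := by simp [bits]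
  rw [e₀] at h
  unfold replaceSet
  convert h using 1
  funext c
  by_cases hc : c = set A
  · subst hc
    simp [List.take_left' (show (bits g n).reverse.length = n by simp)]
  · by_cases hc' : c = acc
    · subst hc'
      simp [List.drop_left' (show (bits g n).reverse.length = n by simp)]
    · simp [hc, hc']

/-- Random access in a stack: shift `k` bits away, copy the top, shift them back. The two shifting
programs stay abstract because matrix access moves whole rows and set access only single bits. -/
theorem does_access {q : Prog Reg} {q' : Prog Reg} {a : Reg} {s : Reg → List Bool} {k T T' : ℕ}
    {b : Bool} (ha : a ≠ acc) (ha' : a ≠ shift) (hs : s shift = []) (hk : (s a)[k]? = some b)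
    (hq : Does q s (update (update s a ((s a).drop k)) shift (((s a).take k).reverse ++ s shift)) T)
    (hq' : ∀ t : Reg → List Bool, (∀ c, c ≠ acc → c ≠ a → c ≠ shift → t c = s c) →
      t shift = ((s a).take k).reverse →
      Does q' t (update (update t shift ((t shift).drop k)) a
        (((t shift).take k).reverse ++ t a)) T') :
    Does (seq q (seq (prim (copy a acc)) q')) s (update s acc (b :: s acc)) (T + (1 + T')) := by
  have hlen : k < (s a).length := by
    by_contra h
    rw [List.getElem?_eq_none (by omega)] at hk
    cases hk
  have h₂ : Does (prim (copy a acc))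
      (update (update s a ((s a).drop k)) shift (((s a).take k).reverse ++ s shift))
      (update (update (update s a ((s a).drop k)) shift ((s a).take k).reverse) acc
        (b :: s acc)) 1 := does_of_prim (by simp [Prim.run, ha.symm, ha', hs, hk])
  have h₃ := hq' (update (update (update s a ((s a).drop k)) shift ((s a).take k).reverse) acc
        (b :: s acc)) (fun c h₁ h₂ h₃ => by simp [h₁, h₂, h₃]) (by simp)
  have h := does_seq hq (does_seq h₂ h₃)
  convert h using 1
  funext c
  by_cases hc : c = a
  · subst hc
    simp [ha, ha', List.take_of_length_le]
  · by_cases hc' : c = shift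
    · subst hc'
      simp [ha'.symm, hs]
    · by_cases hc'' : c = acc
      · subst hc''; simp [hc]
      · simp [hc, hc', hc'']

/-- The program of a formula pushes its value on the accumulator. -/
theorem does_formula (e : Formula) : ∀ (B : ℕ) (E : Env) (s : Reg → List Bool), Holds B E s →
    Does e.prog s (update s acc (e.eval E :: s acc)) (e.cost B) := by
  induction e with
  | adj x y =>
    intro B E s hs
    have hb := hs.mat _ (hs.lt x) _ (hs.lt y)
    have hlen : E.val (vtx x) * E.n + E.val (vtx y) ≤ (s mat).length := by
      by_contra h
      rw [List.getElem?_eq_none (by omega)] at hb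
      cases hb
    have h₁ := does_moveBlocks (r := var (vtx x)) (q := size) (a := mat) (b := shift)
      (by simp) (by simp) (by simp) (hs.val _) hs.lead_size (by omega)
    have h₂ := does_moveMany (r := var (vtx y)) (a := mat) (b := shift) (k := E.val (vtx y))
      (s := update (update s mat ((s mat).drop (E.val (vtx x) * E.n))) shift
        (((s mat).take (E.val (vtx x) * E.n)).reverse ++ s shift)) (by simp)
      (by simpa using hs.val _) (by simp; omega)
    have h₁₂ := does_seq h₁ h₂
    have h := does_access (q := seq (rep (var (vtx x)) (rep size (prim (move mat shift))))
      (rep (var (vtx y)) (prim (move mat shift))))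
      (q' := seq (rep (var (vtx y)) (prim (move shift mat)))
        (rep (var (vtx x)) (rep size (prim (move shift mat))))) (by simp) (by simp) hs.shift hb
      (T := _) (T' := _) (by
        convert h₁₂ using 1
        funext c
        by_cases hc : c = shift
        · subst hc
          simp [List.take_add]
        · by_cases hc' : c = mat
          · subst hc'
            simp
          · simp [hc, hc'])
      (fun t ht ht' => by
        have hx : lead (t (var (vtx x))) = E.val (vtx x) := by
          rw [ht _ (by simp) (by simp) (by simp), hs.val]
        have hy : lead (t (var (vtx y))) = E.val (vtx y) := by
          rw [ht _ (by simp) (by simp) (by simp), hs.val]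
        have hz : lead (t size) = E.n := by
          rw [ht _ (by simp) (by simp) (by simp), hs.lead_size]
        have hl : (t shift).length = E.val (vtx x) * E.n + E.val (vtx y) := by
          simpa [ht'] using hlen
        have g₁ := does_moveMany (r := var (vtx y)) (a := shift) (b := mat) (s := t) (by simp) hy
          (by omega)
        have g₂ := does_moveBlocks (r := var (vtx x)) (q := size) (a := shift) (b := mat)
          (s := update (update t shift ((t shift).drop (E.val (vtx y)))) mat
            (((t shift).take (E.val (vtx y))).reverse ++ t mat)) (k := E.val (vtx x)) (n := E.n)
          (by simp) (by simp) (by simp) (by simpa using hx) (by simpa using hz)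
          (by simp; omega)
        have g := does_seq g₁ g₂
        convert g using 1
        funext c
        by_cases hc : c = mat
        · subst hc
          simp [add_comm (E.val (vtx x) * E.n), List.take_add]
        · by_cases hc' : c = shift
          · subst hc'
            simp [add_comm (E.val (vtx x) * E.n)]
          · simp [hc, hc'])
    refine h.mono ?_
    have hx := hs.val_le (vtx x)
    have hy := hs.val_le (vtx y)
    have hn := hs.le
    rw [Formula.cost]
    have : E.val (vtx x) * (E.n * 4 + 7) ≤ B * (B * 4 + 7) := by gcongr
    omega
  | lt x y =>
    intro B E s hs
    have h₁ := does_pushMany (r := var y) shift true (s := s) (hs.val y)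
    rw [hs.shift, List.append_nil] at h₁
    have h₂ := does_popMany (r := var x) shift (k := E.val x)
      (s := update s shift (List.replicate (E.val y) true)) (by simpa using hs.val x)
    simp only [update_self, update_idem, List.drop_replicate] at h₂
    have h₃ : Does (prim (test shift acc))
        (update s shift (List.replicate (E.val y - E.val x) true))
        (update (update s shift (List.replicate (E.val y - E.val x) true)) acc
          ((Formula.lt x y).eval E :: s acc)) 1 := does_of_prim (by
      have : (List.replicate (E.val y - E.val x) true).head?.isSome =
          (Formula.lt x y).eval E := by
        rw [Formula.eval]
        by_cases h : E.val x < E.val y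
        · obtain ⟨d, hd⟩ := Nat.exists_eq_add_of_lt h
          have : E.val y - E.val x = d + 1 := by omega
          simp [this, h, List.replicate_succ]
        · have : E.val y - E.val x = 0 := by omega
          simp [this, h]
      simp [Prim.run, ← this])
    have h₄ := does_popMany (r := shift) shift (k := E.val y - E.val x)
      (s := update (update s shift (List.replicate (E.val y - E.val x) true)) acc
          ((Formula.lt x y).eval E :: s acc)) (by simp)
    have h := does_seq h₁ (does_seq h₂ (does_seq h₃ h₄))
    have hfin : update (update (update s shift (List.replicate (E.val y - E.val x) true)) acc
          ((Formula.lt x y).eval E :: s acc)) shift (List.drop (E.val y - E.val x)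
          (update (update s shift (List.replicate (E.val y - E.val x) true)) acc
          ((Formula.lt x y).eval E :: s acc) shift)) =
        update s acc ((Formula.lt x y).eval E :: s acc) := by
      funext c
      by_cases hc : c = shift
      · subst hc; simp [hs.shift]
      · by_cases hc' : c = acc
        · subst hc'; simp
        · simp [hc, hc']
    rw [hfin] at h
    refine h.mono ?_
    have := hs.val_le x
    have := hs.val_le y
    rw [Formula.cost]
    omega
  | mem A x =>
    intro B E s hs
    have hlen : E.val (vtx x) ≤ (s (set A)).length := by
      by_contra h
      have := hs.set A _ (hs.lt x)
      rw [List.getElem?_eq_none (by omega)] at this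
      cases this
    refine (does_access (q := rep (var (vtx x)) (prim (move (set A) shift)))
      (q' := rep (var (vtx x)) (prim (move shift (set A)))) (by simp) (by simp) hs.shift
      (hs.set A _ (hs.lt x)) (does_moveMany (by simp) (hs.val _) hlen)
      (fun t ht ht' => does_moveMany (by simp) ?_ ?_)).mono ?_
    · rw [ht _ (by simp) (by simp) (by simp), hs.val]
    · simpa [ht'] using hlen
    · have := hs.val_le (vtx x)
      rw [Formula.cost]
      omega
  | nand φ ψ hφ hψ =>
    intro B E s hs
    exact does_seq (hφ B E s hs) (does_seq (hψ B E _ (hs.update_acc _))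
      (does_of_prim (by simp [Prim.run, Formula.eval, Bool.and_comm])))
  | count c xs φ e hφ he =>
    intro B E s hs
    set m := E.tally φ.eval xs with hm
    have hmB : m ≤ B ^ xs.length := (E.tally_le _ xs).trans (Nat.pow_le_pow_left hs.le _)
    -- The marker separates this count from the unfinished counts of enclosing formulas below it.
    have h₁ : Does (prim (push cnt false)) s (update s cnt (false :: s cnt)) 1 :=
      does_of_prim rfl
    have h₂ := does_forAll (p := seq φ.prog (prim (tally acc cnt))) (f := φ.eval)
      (B := B) (T := φ.cost B + 1) (fun E s hs => by
        refine does_seq (hφ B E s hs) (does_of_prim ?_)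
        funext c
        by_cases hc : c = cnt
        · subst hc
          cases h : φ.eval E <;> simp [Prim.run]
        · by_cases hc' : c = acc
          · subst hc'
            cases h : φ.eval E <;> simp [Prim.run]
          · cases h : φ.eval E <;> simp [Prim.run, hc]) xs E _
      (hs.update_cnt (false :: s cnt))
    simp only [update_self, update_idem, ← hm] at h₂
    set s₁ := update s cnt (List.replicate m true ++ false :: s cnt) with hs₁
    have h₃ : Does (prim (push (var (num c)) false)) s₁
        (update s₁ (var (num c)) (false :: s (var (num c)))) 1 :=
      does_of_prim (by simp [Prim.run, hs₁])
    have h₄ := does_pushMany (r := cnt) (var (num c)) true (k := m)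
      (s := update s₁ (var (num c)) (false :: s (var (num c)))) (by simp [hs₁])
    have h₅ := does_popMany (r := cnt) cnt (k := m)
      (s := update s₁ (var (num c)) (List.replicate m true ++ false :: s (var (num c))))
      (by simp [hs₁])
    have h₆ : Does (prim (pop cnt)) (update (update s₁ (var (num c))
        (List.replicate m true ++ false :: s (var (num c)))) cnt (false :: s cnt))
        (update s (var (num c)) (List.replicate m true ++ false :: s (var (num c)))) 1 := by
      refine does_of_prim ?_
      funext r
      by_cases hr : r = cnt
      · subst hr; simp [Prim.run]
      · by_cases hr' : r = var (num c)
        · subst hr'; simp [Prim.run]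
        · simp [Prim.run, hr, hr', hs₁]
    -- The count can be as large as `B ^ xs.length`, so `e` is evaluated under the enlarged bound.
    have h₇ := he (B + B ^ xs.length) (E.setVal (num c) m) _
      (hs.update_num c (i := m) (B' := B + B ^ xs.length)
        (l := List.replicate m true ++ false :: s (var (num c))) (by omega) (by omega) (by simp))
    set b := e.eval (E.setVal (num c) m) with hb
    have h₈ := does_popMany (r := var (num c)) (var (num c)) (k := m)
      (s := update (update s (var (num c)) (List.replicate m true ++ false :: s (var (num c)))) acc
        (b :: s acc)) (by simp)
    have h₉ : Does (prim (pop (var (num c)))) (update (update s acc (b :: s acc)) (var (num c))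
        (false :: s (var (num c)))) (update s acc (b :: s acc)) 1 := by
      refine does_of_prim ?_
      funext r
      by_cases hr' : r = var (num c)
      · subst hr'; simp [Prim.run]
      · simp [Prim.run, hr']
    simp only [update_self, update_idem] at h₄
    have e₅ : (update s₁ (var (num c)) (List.replicate m true ++ false :: s (var (num c)))) cnt =
        List.replicate m true ++ false :: s cnt := by simp [hs₁]
    rw [e₅, List.drop_left' (by simp)] at h₅
    have e₈ : (update (update s (var (num c)) (List.replicate m true ++ false ::
        s (var (num c)))) acc (b :: s acc)) (var (num c)) =
        List.replicate m true ++ false :: s (var (num c)) := by simp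
    rw [e₈, List.drop_left' (by simp), update_comm (by simp), update_idem,
      update_comm (by simp)] at h₈
    rw [update_of_ne (a := acc) (by simp)] at h₇
    have h := does_seq h₁ (does_seq h₂ (does_seq h₃ (does_seq h₄ (does_seq h₅ (does_seq h₆
      (does_seq h₇ (does_seq h₈ h₉)))))))
    refine Does.mono h ?_
    rw [Formula.cost]
    omega
  | iter A k x φ e hφ he =>
    intro B E s hs
    set op : (ℕ → Bool) → ℕ → Bool :=
      fun f i => φ.eval ((E.setSet A f).setVal (vtx x) i) with hop
    have h₁ := does_pushMany (r := size) (set A) false (k := E.n) (s := s) hs.lead_size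
    have h₂ := does_rep (r := var k) (p := replaceSet A x φ.prog)
      (fun i => update s (set A) (bits (op^[i] fun _ => false) E.n ++ s (set A)))
      (m := E.val k) (T := forCost B (φ.cost B) + ((B * 4 + 4) + (B * 4 + 4)))
      (by simpa using hs.val k)
      (fun i hi => by
        have h := does_replaceSet (A := A) (x := x) (p := φ.prog) (n := E.n) (T := φ.cost B)
          (s := update s (set A) (bits (op^[i] fun _ => false) E.n ++ s (set A)))
          (g := op (op^[i] fun _ => false)) (by simpa using hs.lead_size) (by simp; rfl) (by simp)
          (fun j hj l => by
            have := hφ B ((E.setSet A (op^[i] fun _ => false)).setVal (vtx x) j) _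
              (((hs.update_set A (fun j hj => getElem?_bits_append hj (s (set A)))).update_acc
                l).update_var x hj (l := List.replicate j true ++ false :: s (var (vtx x)))
                  (by simp))
            rw [update_of_ne (a := var (vtx x)) (by simp)]
            rwa [update_update_update (by simp), update_of_ne (a := acc) (by simp),
              update_self] at this)
        rw [update_idem, ← iterate_succ_apply' op] at h
        refine h.mono ?_
        have := hs.le
        have := forCost_mono (T := φ.cost B) this
        omega)
    have h₃ := he B (E.setSet A (op^[E.val k] fun _ => false)) _
      (hs.update_set A (fun j hj => getElem?_bits_append hj (s (set A))))
    have h₄ := does_popMany (r := size) (set A) (k := E.n)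
      (s := update (update s (set A) (bits (op^[E.val k] fun _ => false) E.n ++ s (set A))) acc
        ((Formula.iter A k x φ e).eval E :: s acc)) (by simpa using hs.lead_size)
    -- The pushed zeros are the zeroth iterate. The former value of `A` stays beneath them and
    -- reappears when they are popped at the end.
    have e₁ : List.replicate E.n false = bits (op^[0] fun _ => false) E.n := (bits_false _).symm
    rw [e₁] at h₁
    rw [update_of_ne (a := acc) (by simp)] at h₃
    have h := does_seq h₁ (does_seq h₂ (does_seq h₃ h₄))
    have hfin : update (update (update s (set A) (bits (op^[E.val k] fun _ => false) E.n ++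
        s (set A))) acc ((Formula.iter A k x φ e).eval E :: s acc)) (set A) (List.drop E.n
        (update (update s (set A) (bits (op^[E.val k] fun _ => false) E.n ++
        s (set A))) acc ((Formula.iter A k x φ e).eval E :: s acc) (set A))) =
        update s acc ((Formula.iter A k x φ e).eval E :: s acc) := by
      funext c
      by_cases hc : c = Reg.set A
      · subst hc; simp
      · by_cases hc' : c = acc
        · subst hc'; simp
        · simp [hc, hc']
    rw [hfin] at h
    refine h.mono ?_
    have hk := hs.val_le k
    have hn := hs.le
    rw [Formula.cost]
    have : E.val k * (forCost B (φ.cost B) + ((B * 4 + 4) + (B * 4 + 4)) + 3) ≤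
      B * (forCost B (φ.cost B) + ((B * 4 + 4) + (B * 4 + 4)) + 3) := by gcongr
    omega

end StackProgram

/-! ### Polynomial cost, and the program that iterates a definable operator on an input graph. -/

namespace StackProgram

open Function
open Var Reg Prim Prog

/-- A function is given by a polynomial. -/
def IsPoly (f : ℕ → ℕ) : Prop := ∃ P : Polynomial ℕ, ∀ B, P.eval B = f B

namespace IsPoly

variable {f g : ℕ → ℕ}

theorem const (c : ℕ) : IsPoly fun _ => c := ⟨Polynomial.C c, fun _ => Polynomial.eval_C⟩

theorem id : IsPoly fun B => B := ⟨Polynomial.X, fun _ => Polynomial.eval_X⟩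

theorem add (hf : IsPoly f) (hg : IsPoly g) : IsPoly fun B => f B + g B := by
  obtain ⟨P, hP⟩ := hf
  obtain ⟨Q, hQ⟩ := hg
  exact ⟨P + Q, fun B => by rw [Polynomial.eval_add, hP, hQ]⟩

theorem mul (hf : IsPoly f) (hg : IsPoly g) : IsPoly fun B => f B * g B := by
  obtain ⟨P, hP⟩ := hf
  obtain ⟨Q, hQ⟩ := hg
  exact ⟨P * Q, fun B => by rw [Polynomial.eval_mul, hP, hQ]⟩

theorem comp (hf : IsPoly f) (hg : IsPoly g) : IsPoly fun B => f (g B) := by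
  obtain ⟨P, hP⟩ := hf
  obtain ⟨Q, hQ⟩ := hg
  exact ⟨P.comp Q, fun B => by rw [Polynomial.eval_comp, hQ, hP]⟩

theorem pow (k : ℕ) : IsPoly fun B => B ^ k := ⟨Polynomial.X ^ k, fun B => by simp⟩

theorem lin (hf : IsPoly f) : IsPoly fun B => f B * 4 + 4 := (hf.mul (const 4)).add (const 4)

theorem forCost (hf : IsPoly f) : IsPoly fun B => StackProgram.forCost B (f B) :=
  (id.mul (hf.add (const 8))).add (const 10)

theorem forAllCost (hf : IsPoly f) : ∀ k, IsPoly fun B => StackProgram.forAllCost B (f B) k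
  | 0 => hf
  | k + 1 => (forAllCost hf k).forCost

end IsPoly

/-- The evaluation of a formula takes polynomial time. -/
theorem Formula.isPoly_cost (e : Formula) : IsPoly e.cost := by
  have one := IsPoly.const 1
  have lin := IsPoly.id.lin
  have quad := (IsPoly.id.mul ((IsPoly.id.mul (.const 4)).add (.const 7))).add (.const 4)
  induction e with
  | adj x y => exact (quad.add lin).add (one.add (lin.add quad))
  | lt x y => exact lin.add (lin.add (one.add lin))
  | mem A x => exact lin.add (one.add lin)
  | nand φ ψ hφ hψ => exact hφ.add (hψ.add one)
  | count c xs φ e hφ he =>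
    have p := (IsPoly.pow xs.length).lin
    exact one.add (((hφ.add one).forAllCost _).add (one.add (p.add (p.add (one.add
      ((he.comp (IsPoly.id.add (.pow _))).add (p.add one)))))))
  | iter A k x φ e hφ he =>
    exact lin.add (((IsPoly.id.mul ((hφ.forCost.add (lin.add lin)).add (.const 3))).add
      (.const 4)).add (he.add lin))

/-- The environment of a graph, with nothing assigned. -/
def Env.init (n : ℕ) (adj : ℕ → ℕ → Bool) : Env := ⟨n, adj, fun _ => 0, fun _ _ => false⟩

/-- The operator on sets of vertices that a formula defines. -/
def Formula.operator (φ : Formula) (x : Fin 11) (n : ℕ) (adj : ℕ → ℕ → Bool) (f : ℕ → Bool)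
    (i : ℕ) : Bool :=
  φ.eval (((Env.init n adj).setSet 0 f).setVal (vtx x) i)

/-- Read a graph with `n` vertices and compute the set obtained from the empty set by applying the
operator that `φ` defines `n` times. -/
def Formula.mainProg (φ : Formula) (x : Fin 11) : Prog Reg :=
  seq (rep mat (prim (move mat size)))
    (seq (prim (pop mat))
      (seq (rep size (prim (push (set 1) false)))
        (seq (rep size (prim (push (set 0) false)))
          (seq (rep size (replaceSet 0 x φ.prog))
            (seq (rep size (rep size (prim (pop mat))))
              (seq (rep size (prim (pop (set 1)))) (rep size (prim (pop size)))))))))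

/-- The time of the main program. -/
def Formula.mainCost (φ : Formula) (n : ℕ) : ℕ :=
  (n * 4 + 4) + (1 + ((n * 4 + 4) + ((n * 4 + 4) +
    ((n * (StackProgram.forCost n (φ.cost n) + ((n * 4 + 4) + (n * 4 + 4)) + 3) + 4) +
      ((n * ((n * 4 + 4) + 3) + 4) + ((n * 4 + 4) + (n * 4 + 4)))))))

theorem Formula.isPoly_mainCost (φ : Formula) : IsPoly φ.mainCost := by
  have one := IsPoly.const 1
  have lin := IsPoly.id.lin
  exact lin.add (one.add (lin.add (lin.add (((IsPoly.id.mul ((φ.isPoly_cost.forCost.add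
    (lin.add lin)).add (.const 3))).add (.const 4)).add (((IsPoly.id.mul (lin.add (.const 3))).add
      (.const 4)).add (lin.add lin))))))

/-- The registers when the graph has been read. -/
def loaded (n : ℕ) (l : List Bool) (f : ℕ → Bool) : Reg → List Bool
  | mat => l
  | size => List.replicate n true
  | Reg.set 0 => bits f n
  | Reg.set 1 => List.replicate n false
  | _ => []

theorem update_loaded (n : ℕ) (l : List Bool) (f g : ℕ → Bool) :
    update (loaded n l f) (set 0) (bits g n) = loaded n l g := by
  funext c
  by_cases hc : c = set 0
  · subst hc; simp [loaded]
  · rw [update_of_ne hc]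
    cases c with
    | set A =>
      match A with
      | 0 => exact absurd rfl hc
      | 1 => rfl
    | _ => rfl

/-- An empty stack reads as the number 0, which is a legitimate vertex only because `n` is positive.
-/
theorem holds_loaded {n : ℕ} (hn : 0 < n) {adj : ℕ → ℕ → Bool} {l : List Bool}
    (hl : ∀ i < n, ∀ j < n, l[i * n + j]? = some (adj i j)) (f : ℕ → Bool) :
    Holds n ((Env.init n adj).setSet 0 f) (loaded n l f) where
  size := rfl
  shift := rfl
  mat := hl
  val _ := rfl
  lt _ := hn
  set A i hi := by
    have hi : i < n := hi
    match A with
    | 0 => simpa [Env.setSet, loaded] using getElem?_bits_append hi []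
    | 1 => simp [Env.setSet, loaded, Env.init, hi]
  le := le_rfl
  val_le _ := Nat.zero_le _

/-- After the iteration the matrix, the size and the set `1` are erased, because a halting
configuration must have every stack except the output empty. -/
theorem does_mainProg (φ : Formula) (x : Fin 11) {n : ℕ} (hn : 0 < n) {adj : ℕ → ℕ → Bool}
    {l : List Bool} (hlen : l.length = n * n)
    (hl : ∀ i < n, ∀ j < n, l[i * n + j]? = some (adj i j)) :
    Does (φ.mainProg x) (update (fun _ => []) mat (List.replicate n true ++ false :: l))
      (update (fun _ => []) (set 0) (bits ((φ.operator x n adj)^[n] fun _ => false) n))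
      (φ.mainCost n) := by
  have h₁ := does_moveMany (r := mat) (a := mat) (b := size) (k := n)
    (s := update (fun _ => []) mat (List.replicate n true ++ false :: l)) (by simp) (by simp)
    (by simp)
  have h₂ : Does (prim (pop mat)) (update (update (update (fun _ => []) mat
      (List.replicate n true ++ false :: l)) mat (false :: l)) size (List.replicate n true))
      (update (update (fun _ => []) mat l) size (List.replicate n true)) 1 := by
    refine does_of_prim ?_
    rw [Prim.run, update_of_ne (by simp), update_self, update_idem, update_comm (by simp),
      update_idem, List.tail_cons]
  have h₃ := does_pushMany (r := size) (set 1) false (k := n)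
    (s := update (update (fun _ => []) mat l) size (List.replicate n true)) (by simp)
  have h₄ := does_pushMany (r := size) (set 0) false (k := n)
    (s := update (update (update (fun _ => []) mat l) size (List.replicate n true)) (set 1)
      (List.replicate n false)) (by simp)
  have h₅ := does_rep (r := size) (p := replaceSet 0 x φ.prog)
    (fun i => loaded n l ((φ.operator x n adj)^[i] fun _ => false)) (m := n)
    (T := StackProgram.forCost n (φ.cost n) + ((n * 4 + 4) + (n * 4 + 4)))
    (by simp [loaded])
    (fun i hi => by
      set f := (φ.operator x n adj)^[i] fun _ => false with hf
      have h := does_replaceSet (A := 0) (x := x) (p := φ.prog) (n := n) (T := φ.cost n)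
        (s := loaded n l f) (b := bits f n) (r := [])
        (g := φ.operator x n adj f) (by simp [loaded]) (by simp [loaded]) (by simp)
        (fun j hj l' => by
          have := does_formula φ n _ _ (((holds_loaded hn hl f).update_acc l').update_var x hj
            (l := List.replicate j true ++ false :: loaded n l f (var (vtx x))) (by simp))
          rwa [update_update_update (by simp), update_of_ne (a := acc) (by simp),
            update_self] at this)
      rw [List.append_nil, update_loaded, hf, ← iterate_succ_apply' (φ.operator x n adj)] at h
      exact h)
  set f := (φ.operator x n adj)^[n] fun _ => false with hf
  have h₆ := does_rep (r := size) (p := rep size (prim (pop mat)))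
    (fun i => update (loaded n l f) mat (l.drop (i * n))) (m := n) (T := n * 4 + 4)
    (by simp [loaded])
    (fun i hi => by
      have := does_popMany (r := size) mat (k := n)
        (s := update (loaded n l f) mat (l.drop (i * n))) (by simp [loaded])
      simpa [add_mul] using this)
  have h₇ := does_popMany (r := size) (set 1) (k := n)
    (s := update (loaded n l f) mat []) (by simp [loaded])
  have h₈ := does_popMany (r := size) size (k := n)
    (s := update (update (loaded n l f) mat []) (set 1) []) (by simp [loaded])
  have e₁ : update (update (update (fun _ => []) mat (List.replicate n true ++ false :: l)) mat
      (List.drop n (update (fun _ => []) mat (List.replicate n true ++ false :: l) mat))) size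
      ((List.take n (update (fun _ => []) mat
        (List.replicate n true ++ false :: l) mat)).reverse ++
        update (fun _ => []) mat (List.replicate n true ++ false :: l) size) =
      update (update (update (fun _ => []) mat
      (List.replicate n true ++ false :: l)) mat (false :: l)) size (List.replicate n true) := by
    rw [update_self, update_of_ne (by simp), List.append_nil, List.drop_left' (by simp),
      List.take_left' (by simp), List.reverse_replicate]
  have e₄ : update (update (update (update (fun _ => []) mat l) size (List.replicate n true))
      (set 1) (List.replicate n false)) (set 0) (List.replicate n false) =
      loaded n l fun _ => false := by
    funext c
    cases c with
    | set A =>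
      match A with
      | 0 => simp [loaded, bits_false]
      | 1 => simp [loaded]
    | _ => simp [loaded]
  rw [e₁] at h₁
  rw [update_of_ne (a := set 1) (by simp), update_of_ne (a := set 1) (by simp),
    List.append_nil] at h₃
  rw [update_of_ne (a := set 0) (by simp), update_of_ne (a := set 0) (by simp),
    update_of_ne (a := set 0) (by simp), List.append_nil, e₄] at h₄
  have e₆ : update (loaded n l f) mat (l.drop (0 * n)) = loaded n l f := by
    rw [zero_mul, List.drop_zero]
    exact update_eq_self mat (loaded n l f)
  have e₆' : l.drop (n * n) = [] := by simp [hlen]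
  simp only [e₆, e₆'] at h₆
  have e₇ : (update (loaded n l f) mat [] (set 1)).drop n = [] := by simp [loaded]
  have e₈ : (update (update (loaded n l f) mat []) (set 1) [] size).drop n = [] := by simp [loaded]
  rw [e₇] at h₇
  rw [e₈] at h₈
  have hfin : update (update (update (loaded n l f) mat []) (set 1) []) size [] =
      update (fun _ => []) (Reg.set 0) (bits f n) := by
    funext c
    cases c with
    | set A =>
      match A with
      | 0 => simp [loaded]
      | 1 => simp
    | _ => simp [loaded]
  rw [hfin] at h₈
  exact does_seq h₁ (does_seq h₂ (does_seq h₃ (does_seq h₄ (does_seq h₅ (does_seq h₆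
    (does_seq h₇ h₈))))))

end StackProgram

/-! ### Encodings of graphs, and machines for definable operators. -/

namespace EdgeMetric

open StackProgram

theorem length_flatten_of_forall {α : Type*} {n : ℕ} {L : List (List α)}
    (h : ∀ l ∈ L, l.length = n) : L.flatten.length = L.length * n := by
  induction L with
  | nil => simp
  | cons l L ih =>
    rw [List.flatten_cons, List.length_append, ih fun l hl => h l (List.mem_cons_of_mem _ hl),
      h l List.mem_cons_self, List.length_cons]
    ring

theorem getElem?_flatten_of_forall {α : Type*} {n : ℕ} {L : List (List α)}
    (h : ∀ l ∈ L, l.length = n) (i : ℕ) {j : ℕ} (hj : j < n) :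
    L.flatten[i * n + j]? = L[i]?.bind (·[j]?) := by
  induction L generalizing i with
  | nil => simp
  | cons l L ih =>
    have hl := h l List.mem_cons_self
    rw [List.flatten_cons]
    cases i with
    | zero =>
      rw [List.getElem?_append_left (by omega)]
      simp
    | succ i =>
      rw [List.getElem?_append_right (by rw [hl, add_mul]; omega), hl,
        show (i + 1) * n + j - n = i * n + j by rw [add_mul]; omega,
        ih fun l hl => h l (List.mem_cons_of_mem _ hl)]
      simp

/-- The coefficients are natural numbers. This turns a bound in the order into one in the input
length, which is at least the order because of the unary prefix. -/
theorem eval_mono (P : Polynomial ℕ) {a b : ℕ} (h : a ≤ b) : P.eval a ≤ P.eval b := by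
  induction P using Polynomial.induction_on' with
  | add p q hp hq => simpa using add_le_add hp hq
  | monomial n c => simpa using Nat.mul_le_mul_left c (Nat.pow_le_pow_left h n)

/-- The adjacency relation of a graph, on numbers. -/
noncomputable def ConnectedGraph.adj (X : ConnectedGraph) (i j : ℕ) : Bool :=
  open Classical in
  decide (∃ (hi : i < X.order) (hj : j < X.order), X.graph.Adj ⟨i, hi⟩ ⟨j, hj⟩)

theorem ConnectedGraph.adj_iff (X : ConnectedGraph) (i j : Fin X.order) :
    X.adj i j = true ↔ X.graph.Adj i j := by
  simp [adj]

/-- The set of vertices obtained from the empty set by iterating the operator that a formula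
defines. -/
noncomputable def outputSet (φ : Formula) (x : Fin 11) (X : ConnectedGraph) :
    Finset (Fin X.order) :=
  Finset.univ.filter fun i => (φ.operator x X.order X.adj)^[X.order] (fun _ => false) i = true

open Classical in
theorem computable_outputSet (φ : Formula) (x : Fin 11) :
    Nonempty (Turing.TM2ComputableInPolyTime encodeGraph encodeVertexSet
      (fun X : ConnectedGraph => (⟨X.order, outputSet φ x X⟩ : Σ n : ℕ, Finset (Fin n)))) := by
  obtain ⟨P, hP⟩ := φ.isPoly_mainCost
  have key : ∀ X : ConnectedGraph, Does (φ.mainProg x)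
      (Function.update (fun _ => []) Reg.mat (encodeGraph X))
      (Function.update (fun _ => []) (Reg.set 0)
        (encodeVertexSet ⟨X.order, outputSet φ x X⟩)) (φ.mainCost X.order) := by
    intro X
    have hpos : 0 < X.order := by
      obtain ⟨i⟩ := X.connected.nonempty
      exact i.pos
    have hlen : ∀ l ∈ List.ofFn fun i => List.ofFn fun j => decide (X.graph.Adj i j),
        l.length = X.order := by
      intro l hl
      obtain ⟨i, rfl⟩ := (List.mem_ofFn' _ _).1 hl
      simp
    have h := does_mainProg φ x hpos (adj := X.adj)
      (l := (List.ofFn fun i => List.ofFn fun j => decide (X.graph.Adj i j)).flatten)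
      (by rw [length_flatten_of_forall hlen, List.length_ofFn])
      (fun i hi j hj => by
        rw [getElem?_flatten_of_forall hlen i hj]
        simp [hi, hj, ConnectedGraph.adj])
    have e : encodeVertexSet ⟨X.order, outputSet φ x X⟩ =
        bits ((φ.operator x X.order X.adj)^[X.order] fun _ => false) X.order := by
      unfold encodeVertexSet bits outputSet
      apply List.ext_getElem
      · simp
      · intro i h₁ h₂
        simp
    rw [e]
    exact h
  refine computable_of_run _ _ _ (φ.mainProg x) Reg.mat (Reg.set 0) (P + 1)
    (fun X => (key X).1) fun X => ?_
  have h₁ := (key X).2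
  have h₂ : P.eval X.order ≤ P.eval (encodeGraph X).length :=
    eval_mono P (by simp [encodeGraph])
  rw [hP] at h₂
  rw [Polynomial.eval_add, Polynomial.eval_one]
  omega

end EdgeMetric

/-! ## The greedy algorithm for set cover -/

namespace GreedyCover

open Finset

section

variable {V T : Type*} [Fintype V] [LinearOrder V] (U : Finset T) (D : V → T → Prop)

open Classical in
/-- The elements of `U` that are not covered by `S`. -/
noncomputable def uncovered (S : Finset V) : Finset T := U.filter fun τ => ∀ s ∈ S, ¬ D s τ

open Classical in
/-- The number of elements that `v` covers in addition to those covered by `S`. -/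
noncomputable def gain (S : Finset V) (v : V) : ℕ := ((uncovered U D S).filter (D v)).card

/-- The greedy choice: the first `v` that has maximal positive gain. -/
def IsChoice (S : Finset V) (v : V) : Prop :=
  0 < gain U D S v ∧ (∀ w, gain U D S w ≤ gain U D S v) ∧ ∀ w < v, gain U D S w < gain U D S v

open Classical in
/-- One step of the greedy algorithm. -/
noncomputable def step (S : Finset V) : Finset V :=
  univ.filter fun v => v ∈ S ∨ IsChoice U D S v

variable {U D}

theorem mem_uncovered {S : Finset V} {τ : T} :
    τ ∈ uncovered U D S ↔ τ ∈ U ∧ ∀ s ∈ S, ¬ D s τ := by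
  classical
  exact mem_filter

theorem gain_pos_iff {S : Finset V} {v : V} :
    0 < gain U D S v ↔ ∃ τ, τ ∈ uncovered U D S ∧ D v τ := by
  classical
  rw [gain, card_pos]
  exact ⟨fun ⟨τ, hτ⟩ => ⟨τ, mem_filter.1 hτ⟩, fun ⟨τ, hτ⟩ => ⟨τ, mem_filter.2 hτ⟩⟩

theorem mem_step {S : Finset V} {v : V} :
    v ∈ step U D S ↔ v ∈ S ∨ IsChoice U D S v := by
  classical
  simp [step]

/-- The linear order breaks ties, so `step`, although defined by a condition on each vertex
separately, adds at most one vertex. -/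
theorem isChoice_unique {S : Finset V} {v w : V} (hv : IsChoice U D S v) (hw : IsChoice U D S w) :
    v = w := by
  rcases lt_trichotomy v w with h | h | h
  · exact absurd (hw.2.2 v h) (not_lt.2 (hv.2.1 w))
  · exact h
  · exact absurd (hv.2.2 w h) (not_lt.2 (hw.2.1 v))

theorem gain_eq_zero {S : Finset V} {v : V} (hv : v ∈ S) : gain U D S v = 0 := by
  classical
  rw [gain, card_eq_zero, filter_eq_empty_iff]
  intro τ hτ
  exact (mem_filter.1 hτ).2 v hv

theorem step_eq_self {S : Finset V} (h : uncovered U D S = ∅) : step U D S = S := by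
  classical
  ext v
  rw [mem_step, or_iff_left_iff_imp]
  intro hv
  have := hv.1
  simp [gain, h] at this

theorem exists_isChoice {S : Finset V} {v : V} (hv : 0 < gain U D S v) :
    ∃ w, IsChoice U D S w := by
  classical
  obtain ⟨u, -, hu⟩ := exists_max_image univ (gain U D S) ⟨v, mem_univ v⟩
  obtain ⟨w, hw⟩ := (univ.filter fun w => gain U D S w = gain U D S u).exists_minimal
    ⟨u, by simp⟩
  have hw₁ : gain U D S w = gain U D S u := by simpa using hw.prop
  refine ⟨w, ?_, fun x => hw₁ ▸ hu x (mem_univ x), fun x hx => ?_⟩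
  · rw [hw₁]
    exact hv.trans_le (hu v (mem_univ v))
  · refine lt_of_le_of_ne (hw₁ ▸ hu x (mem_univ x)) fun h => ?_
    exact hw.not_prop_of_lt hx (by simp [h, hw₁])

theorem step_eq_insert {S : Finset V} {v : V} (hv : IsChoice U D S v) :
    step U D S = insert v S := by
  classical
  ext w
  rw [mem_step, mem_insert, or_comm]
  exact or_congr_left ⟨fun h => isChoice_unique h hv, fun h => h ▸ hv⟩

theorem uncovered_insert_card {S : Finset V} {v : V} :
    (uncovered U D (insert v S)).card + gain U D S v = (uncovered U D S).card := by
  classical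
  have : uncovered U D (insert v S) = (uncovered U D S).filter fun τ => ¬ D v τ := by
    ext τ
    simp only [uncovered, mem_filter, mem_insert, forall_eq_or_imp]
    tauto
  rw [this, gain, add_comm]
  exact card_filter_add_card_filter_not _

/-- Some element of a cover of size `k` covers a `k`-th part of what is uncovered. -/
theorem uncovered_card_le {S K : Finset V} (hK : ∀ τ ∈ U, ∃ v ∈ K, D v τ) {g : ℕ}
    (hg : ∀ w, gain U D S w ≤ g) : (uncovered U D S).card ≤ K.card * g := by
  classical
  calc (uncovered U D S).card ≤ (K.biUnion fun v => (uncovered U D S).filter (D v)).card := by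
        refine card_le_card fun τ hτ => ?_
        obtain ⟨v, hv, hvτ⟩ := hK τ (mem_filter.1 hτ).1
        exact mem_biUnion.2 ⟨v, hv, mem_filter.2 ⟨hτ, hvτ⟩⟩
    _ ≤ ∑ v ∈ K, gain U D S v := card_biUnion_le
    _ ≤ K.card * g := by
        rw [← smul_eq_mul]
        exact sum_le_card_nsmul _ _ _ fun v _ => hg v

theorem exists_isChoice_of_uncovered {S K : Finset V} (hK : ∀ τ ∈ U, ∃ v ∈ K, D v τ)
    (h : uncovered U D S ≠ ∅) : ∃ v, IsChoice U D S v := by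
  by_contra hno
  have hg : ∀ w, gain U D S w ≤ 0 := by
    intro w
    by_contra hw
    exact hno (exists_isChoice (not_le.1 hw))
  have := uncovered_card_le hK hg
  rw [mul_zero, Nat.le_zero, card_eq_zero] at this
  exact h this

/-- The greedy algorithm finds a cover. -/
theorem uncovered_iterate {K : Finset V} (hK : ∀ τ ∈ U, ∃ v ∈ K, D v τ) :
    uncovered U D ((step U D)^[Fintype.card V] ∅) = ∅ := by
  classical
  -- As long as something is uncovered, each step adds a new vertex: members of the set have gain
  -- zero.
  have key : ∀ t, uncovered U D ((step U D)^[t] ∅) = ∅ ∨ ((step U D)^[t] ∅).card = t := by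
    intro t
    induction t with
    | zero => right; simp
    | succ t ih =>
      rw [Function.iterate_succ_apply']
      by_cases h : uncovered U D ((step U D)^[t] ∅) = ∅
      · left; rwa [step_eq_self h]
      · right
        obtain ⟨v, hv⟩ := exists_isChoice_of_uncovered hK h
        rw [step_eq_insert hv, card_insert_of_notMem, ih.resolve_left h]
        intro hmem
        exact hv.1.ne' (gain_eq_zero hmem)
  rcases key (Fintype.card V) with h | h
  · exact h
  · rw [card_eq_iff_eq_univ] at h
    rw [h]
    refine filter_eq_empty_iff.2 fun τ hτ hno => ?_
    obtain ⟨v, -, hv⟩ := hK τ hτ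
    exact hno v (mem_univ v) hv

theorem iterate_eq_empty (hU : U = ∅) (t : ℕ) : (step U D)^[t] ∅ = ∅ := by
  induction t with
  | zero => rfl
  | succ t ih =>
    rw [Function.iterate_succ_apply', ih, step_eq_self]
    simp [uncovered, hU]

/-- The greedy algorithm finds a cover whose size is optimal up to a logarithmic factor. -/
theorem card_iterate_le {K : Finset V} (hK : ∀ τ ∈ U, ∃ v ∈ K, D v τ) (t : ℕ) :
    (((step U D)^[t] ∅).card : ℝ) ≤ K.card * Real.log U.card + 1 := by
  classical
  -- The exponential decay is carried along because the size bound after the next step is read off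
  -- from it.
  have key : ∀ t, (((step U D)^[t] ∅).card : ℝ) ≤ K.card * Real.log U.card + 1 ∧
      (uncovered U D ((step U D)^[t] ∅) ≠ ∅ → ((uncovered U D ((step U D)^[t] ∅)).card : ℝ) ≤
        U.card * Real.exp (-((((step U D)^[t] ∅).card : ℝ) / K.card))) := by
    intro t
    induction t with
    | zero =>
      refine ⟨?_, fun _ => ?_⟩
      · have : (0 : ℝ) ≤ Real.log U.card := Real.log_natCast_nonneg _
        simp only [Function.iterate_zero, id_eq, card_empty, Nat.cast_zero]
        positivity
      · simp only [Function.iterate_zero, id_eq, card_empty, Nat.cast_zero, zero_div, neg_zero,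
          Real.exp_zero, mul_one]
        exact_mod_cast card_filter_le U _
    | succ t ih =>
      rw [Function.iterate_succ_apply']
      set S := (step U D)^[t] ∅ with hS
      by_cases h : uncovered U D S = ∅
      · rw [step_eq_self h]
        exact ih
      · obtain ⟨v, hv⟩ := exists_isChoice_of_uncovered hK h
        have hvS : v ∉ S := fun hmem => hv.1.ne' (gain_eq_zero hmem)
        have hu := ih.2 h
        have h₁ : 1 ≤ (uncovered U D S).card := card_pos.2 (nonempty_iff_ne_empty.2 h)
        have h₂ := uncovered_card_le hK hv.2.1
        have h₃ := uncovered_insert_card (U := U) (D := D) (S := S) (v := v)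
        have hk : 0 < K.card := by
          rcases Nat.eq_zero_or_pos K.card with h0 | h0
          · rw [h0] at h₂; omega
          · exact h0
        have hk' : (0 : ℝ) < K.card := by exact_mod_cast hk
        rw [step_eq_insert hv, card_insert_of_notMem hvS]
        push_cast
        constructor
        -- At least one element was uncovered before this choice; taking logarithms bounds the old
        -- size by k log|U|, and the new choice accounts for the + 1.
        · have h₄ : (1 : ℝ) ≤ U.card * Real.exp (-((S.card : ℝ) / K.card)) :=
            le_trans (by exact_mod_cast h₁) hu
          have hU : (0 : ℝ) < U.card := by
            have : 0 < U.card := lt_of_lt_of_le h₁ (card_filter_le _ _)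
            exact_mod_cast this
          have h₅ := Real.log_le_log one_pos h₄
          rw [Real.log_one, Real.log_mul hU.ne' (Real.exp_pos _).ne', Real.log_exp] at h₅
          have h₆ : (S.card : ℝ) / K.card ≤ Real.log U.card := by linarith
          rw [div_le_iff₀ hk'] at h₆
          linarith
        · intro _
          have h₄ : ((uncovered U D S).card : ℝ) ≤ K.card * gain U D S v := by exact_mod_cast h₂
          have h₅ : ((uncovered U D (insert v S)).card : ℝ) + gain U D S v =
              (uncovered U D S).card := by exact_mod_cast h₃
          have h₆ : ((uncovered U D S).card : ℝ) / K.card ≤ gain U D S v := by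
            rw [div_le_iff₀ hk']; linarith
          have h₇ : 1 - 1 / (K.card : ℝ) ≤ Real.exp (-(1 / (K.card : ℝ))) := by
            have := Real.add_one_le_exp (-(1 / (K.card : ℝ)))
            linarith
          calc ((uncovered U D (insert v S)).card : ℝ)
              ≤ (uncovered U D S).card * (1 - 1 / K.card) := by
                rw [mul_sub, mul_one, mul_one_div]; linarith
            _ ≤ (uncovered U D S).card * Real.exp (-(1 / (K.card : ℝ))) := by gcongr
            _ ≤ (U.card * Real.exp (-((S.card : ℝ) / K.card))) *
                Real.exp (-(1 / (K.card : ℝ))) := by gcongr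
            _ = U.card * Real.exp (-(((S.card : ℝ) + 1) / K.card)) := by
                rw [mul_assoc, ← Real.exp_add]
                congr 2
                ring
  exact (key t).1

end

end GreedyCover

/-! ## The formula of the greedy algorithm for edge metric generators -/

namespace StackProgram

open Var

namespace Formula

/-- Negation. -/
def neg (φ : Formula) : Formula := nand φ φ

/-- Conjunction. -/
def conj (φ ψ : Formula) : Formula := neg (nand φ ψ)

/-- Disjunction. -/
def disj (φ ψ : Formula) : Formula := nand (neg φ) (neg ψ)

/-- Existential quantification over the vertices. -/
def ex (x : Fin 11) (φ : Formula) : Formula :=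
  count 0 [x] φ (count 1 [] (lt (num 0) (num 0)) (lt (num 1) (num 0)))

@[simp] theorem eval_adj (x y : Fin 11) (E : Env) :
    (adj x y).eval E = E.adj (E.val (vtx x)) (E.val (vtx y)) := rfl

@[simp] theorem eval_lt (x y : Var) (E : Env) :
    (lt x y).eval E = true ↔ E.val x < E.val y := by simp [eval]

@[simp] theorem eval_mem (A : Fin 2) (x : Fin 11) (E : Env) :
    (mem A x).eval E = E.sets A (E.val (vtx x)) := rfl

@[simp] theorem eval_nand (φ ψ : Formula) (E : Env) :
    (nand φ ψ).eval E = true ↔ ¬ (φ.eval E = true ∧ ψ.eval E = true) := by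
  rw [eval]
  cases φ.eval E <;> cases ψ.eval E <;> simp

@[simp] theorem eval_neg (φ : Formula) (E : Env) :
    (neg φ).eval E = true ↔ ¬ φ.eval E = true := by simp [neg]

@[simp] theorem eval_conj (φ ψ : Formula) (E : Env) :
    (conj φ ψ).eval E = true ↔ φ.eval E = true ∧ ψ.eval E = true := by simp [conj]

@[simp] theorem eval_disj (φ ψ : Formula) (E : Env) :
    (disj φ ψ).eval E = true ↔ φ.eval E = true ∨ ψ.eval E = true := by
  rw [disj, eval_nand, eval_neg, eval_neg]
  tauto

-- The inner count in `ex` runs over the empty tuple with a false condition, so number `1` is the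
-- constant 0 against which the count of witnesses is compared.
@[simp] theorem eval_ex (x : Fin 11) (φ : Formula) (E : Env) :
    (ex x φ).eval E = true ↔ ∃ i < E.n, φ.eval (E.setVal (vtx x) i) = true := by
  rw [ex, eval, eval, eval_lt]
  simp [Env.setVal, Env.tally, eval, Finset.sum_pos_iff, Nat.pos_iff_ne_zero]

end Formula

@[simp] theorem Env.setVal_n (E : Env) (x : Var) (i : ℕ) : (E.setVal x i).n = E.n := rfl
@[simp] theorem Env.setVal_adj (E : Env) (x : Var) (i : ℕ) : (E.setVal x i).adj = E.adj := rfl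
@[simp] theorem Env.setVal_sets (E : Env) (x : Var) (i : ℕ) : (E.setVal x i).sets = E.sets := rfl
@[simp] theorem Env.setSet_n (E : Env) (A : Fin 2) (f : ℕ → Bool) : (E.setSet A f).n = E.n := rfl
@[simp] theorem Env.setSet_adj (E : Env) (A : Fin 2) (f : ℕ → Bool) :
    (E.setSet A f).adj = E.adj := rfl
@[simp] theorem Env.setSet_val (E : Env) (A : Fin 2) (f : ℕ → Bool) :
    (E.setSet A f).val = E.val := rfl
@[simp] theorem Env.setVal_self (E : Env) (x : Var) (i : ℕ) : (E.setVal x i).val x = i := by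
  simp [setVal]
@[simp] theorem Env.setVal_of_ne (E : Env) {x y : Var} (h : y ≠ x) (i : ℕ) :
    (E.setVal x i).val y = E.val y := by
  simp [setVal, h]
@[simp] theorem Env.setSet_self (E : Env) (A : Fin 2) (f : ℕ → Bool) :
    (E.setSet A f).sets A = f := by
  simp [setSet]
namespace Formula

/-- The set `1` becomes the set of the vertex `v` and the neighbours of the elements of the
set `1`. -/
def ballOp (v : Fin 11) : Formula :=
  disj (conj (neg (lt (vtx 8) (vtx v))) (neg (lt (vtx v) (vtx 8))))
    (ex 9 (conj (mem 1 9) (adj 9 8)))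

/-- The set `1` contains an end of the edge `pq`. -/
def hit (p q : Fin 11) : Formula := disj (mem 1 p) (mem 1 q)

/-- The vertex `v` distinguishes the edge between the vertices `0` and `1` from that between the
vertices `2` and `3`. -/
def dist (v : Fin 11) : Formula :=
  ex 7 (iter 1 (vtx 7) 8 (ballOp v)
    (conj (disj (hit 0 1) (hit 2 3)) (nand (hit 0 1) (hit 2 3))))

/-- The vertices `0` and `1` and the vertices `2` and `3` form edges that `v` distinguishes and
that no element of the set `0` distinguishes. -/
def fresh (v : Fin 11) : Formula :=
  conj (conj (adj 0 1) (adj 2 3)) (conj (neg (ex 6 (conj (mem 0 6) (dist 6)))) (dist v))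

/-- The gain of `v` is less than that of `w`. -/
def less (v w : Fin 11) : Formula :=
  count 0 [0, 1, 2, 3] (fresh v) (count 1 [0, 1, 2, 3] (fresh w) (lt (num 0) (num 1)))

/-- The gain of `v` is positive. -/
def gains (v : Fin 11) : Formula := ex 0 (ex 1 (ex 2 (ex 3 (fresh v))))

/-- The vertex `4` is in the set `0`, or it is the first vertex of maximal positive gain. -/
def greedy : Formula :=
  disj (mem 0 4) (conj (gains 4) (conj (neg (ex 5 (less 4 5)))
    (neg (ex 5 (conj (lt (vtx 5) (vtx 4)) (neg (less 5 4)))))))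

end Formula

end StackProgram

/-! ### Distances in a connected graph and the formulas that express them. -/

namespace EdgeMetric

open StackProgram Var

theorem edgeDist_mk {V : Type*} (G : SimpleGraph V) (a b v : V) :
    edgeDist G s(a, b) v = min (G.dist a v) (G.dist b v) := rfl

/-- The recursion behind `ballOp`, seen along the first edge of a shortest walk. With strict
inequality the iteration starts from the empty set. -/
theorem dist_lt_succ_iff {V : Type*} {G : SimpleGraph V} (hG : G.Connected) (x v : V) (k : ℕ) :
    G.dist x v < k + 1 ↔ x = v ∨ ∃ y, G.dist y v < k ∧ G.Adj y x := by
  constructor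
  · intro h
    obtain ⟨p, hp⟩ := hG.exists_walk_length_eq_dist x v
    cases p with
    | nil => exact Or.inl rfl
    | @cons _ y _ hxy q =>
      refine Or.inr ⟨y, ?_, hxy.symm⟩
      have := SimpleGraph.dist_le q
      rw [SimpleGraph.Walk.length_cons] at hp
      omega
  · rintro (rfl | ⟨y, hy, hyx⟩)
    · simp
    · have h₁ := hG.dist_triangle (u := x) (v := y) (w := v)
      have h₂ := SimpleGraph.dist_eq_one_iff_adj.2 hyx.symm
      omega

/-- A shortest walk is a path. Hence radii below n suffice, and a vertex variable can serve as the
radius. -/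
theorem dist_lt_card {V : Type*} [Fintype V] {G : SimpleGraph V} (hG : G.Connected) (x v : V) :
    G.dist x v < Fintype.card V := by
  obtain ⟨p, hp⟩ := hG.exists_walk_length_eq_dist x v
  rw [← hp]
  exact (p.isPath_of_length_eq_dist hp).length_lt

/-- The environment describes the graph `X`. -/
structure Describes (X : ConnectedGraph) (E : Env) : Prop where
  n : E.n = X.order
  adj : E.adj = X.adj
  lt : ∀ x, E.val (vtx x) < X.order

namespace Describes

variable {X : ConnectedGraph} {E : Env}

/-- The vertex that is the value of a variable. -/
def vertex (h : Describes X E) (x : Fin 11) : Fin X.order := ⟨E.val (vtx x), h.lt x⟩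

theorem setVal (h : Describes X E) (x : Fin 11) {i : ℕ} (hi : i < E.n) :
    Describes X (E.setVal (vtx x) i) :=
  ⟨h.n, h.adj, fun y => by
    by_cases hy : y = x
    · subst hy; simpa [← h.n] using hi
    · simpa [hy] using h.lt y⟩

theorem setNum (h : Describes X E) (c : Fin 2) (i : ℕ) : Describes X (E.setVal (num c) i) :=
  ⟨h.n, h.adj, fun y => by simpa using h.lt y⟩

theorem setSet (h : Describes X E) (A : Fin 2) (f : ℕ → Bool) : Describes X (E.setSet A f) :=
  ⟨h.n, h.adj, h.lt⟩

theorem eval_ball (h : Describes X E) {v : Fin 11} (h₈ : v ≠ 8) (k : ℕ)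
    (i : Fin X.order) :
    (fun f i => (Formula.ballOp v).eval ((E.setSet 1 f).setVal (vtx 8) i))^[k]
      (fun _ => false) i = true ↔ X.graph.dist i (h.vertex v) < k := by
  induction k generalizing i with
  | zero => simp
  | succ k ih =>
    rw [Function.iterate_succ_apply', dist_lt_succ_iff X.connected]
    generalize (fun f i => (Formula.ballOp v).eval ((E.setSet 1 f).setVal (vtx 8) i))^[k]
      (fun _ => false) = g at ih ⊢
    simp only [Formula.ballOp, Formula.eval_disj, Formula.eval_conj, Formula.eval_neg,
      Formula.eval_lt, Formula.eval_ex, Formula.eval_mem, Formula.eval_adj]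
    refine or_congr ?_ ?_
    · simp only [Env.setVal_self, ne_eq, vtx.injEq, h₈, not_false_eq_true, Env.setVal_of_ne,
        Env.setSet_val, Fin.ext_iff, vertex]
      omega
    · constructor
      · rintro ⟨j, hj, hj₁, hj₂⟩
        have hj' : j < X.order := by simpa [h.n] using hj
        refine ⟨⟨j, hj'⟩, (ih ⟨j, hj'⟩).1 (by simpa using hj₁), ?_⟩
        rw [← X.adj_iff]
        simpa [h.adj] using hj₂
      · rintro ⟨y, hy₁, hy₂⟩
        refine ⟨y, by simp [h.n], by simpa using (ih y).2 hy₁, ?_⟩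
        rw [← X.adj_iff] at hy₂
        simpa [h.adj] using hy₂

/-- Two numbers differ iff some threshold lies above exactly one of them, and an edge is at distance
less than k iff one of its ends is in the ball. The conditions on `v` avoid capture by the variables
`7` and `8`. -/
theorem eval_dist (h : Describes X E) {v : Fin 11} (h₇ : v ≠ 7) (h₈ : v ≠ 8) :
    (Formula.dist v).eval E = true ↔ Distinguishes X.graph (h.vertex v)
      s(h.vertex 0, h.vertex 1) s(h.vertex 2, h.vertex 3) := by
  have hball : ∀ k (hk : k < E.n) (x : Fin 11), x ≠ 7 →
      ((fun f i => (Formula.ballOp v).eval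
        (((E.setVal (vtx 7) k).setSet 1 f).setVal (vtx 8) i))^[k] (fun _ => false)
        (E.val (vtx x)) = true ↔ X.graph.dist (h.vertex x) (h.vertex v) < k) := by
    intro k hk x hx
    have := (h.setVal 7 hk).eval_ball h₈ k (h.vertex x)
    have e : (h.setVal 7 hk).vertex v = h.vertex v := by simp [vertex, h₇]
    rwa [e] at this
  rw [Formula.dist, Formula.eval_ex, Distinguishes, edgeDist_mk, edgeDist_mk]
  have key : ∀ k (hk : k < E.n), ((Formula.iter 1 (vtx 7) 8 (Formula.ballOp v)
      (.conj (.disj (.hit 0 1) (.hit 2 3)) (.nand (.hit 0 1) (.hit 2 3)))).eval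
      (E.setVal (vtx 7) k) = true ↔
      (min (X.graph.dist (h.vertex 0) (h.vertex v)) (X.graph.dist (h.vertex 1) (h.vertex v)) < k ∨
      min (X.graph.dist (h.vertex 2) (h.vertex v)) (X.graph.dist (h.vertex 3) (h.vertex v)) < k) ∧
      ¬ (min (X.graph.dist (h.vertex 0) (h.vertex v)) (X.graph.dist (h.vertex 1) (h.vertex v)) < k ∧
      min (X.graph.dist (h.vertex 2) (h.vertex v)) (X.graph.dist (h.vertex 3) (h.vertex v)) < k)) := by
    intro k hk
    simp only [min_lt_iff, ← hball k hk 0 (by decide), ← hball k hk 1 (by decide),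
      ← hball k hk 2 (by decide), ← hball k hk 3 (by decide)]
    rw [Formula.eval]
    simp [Formula.hit]
  have hlt : ∀ x, X.graph.dist (h.vertex x) (h.vertex v) < E.n := fun x => by
    rw [h.n]
    simpa using dist_lt_card X.connected (h.vertex x) (h.vertex v)
  have h0 := hlt 0
  have h2 := hlt 2
  constructor
  · rintro ⟨k, hk, hk'⟩
    rw [key k hk] at hk'
    omega
  · intro hne
    rcases lt_or_gt_of_ne hne with hlt | hlt
    -- The threshold is the smaller distance plus one; it does not exceed the larger distance and so
    -- is still below n.
    · refine ⟨_, ?_, (key (min (X.graph.dist (h.vertex 0) (h.vertex v))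
        (X.graph.dist (h.vertex 1) (h.vertex v)) + 1) ?_).2 ?_⟩ <;> omega
    · refine ⟨_, ?_, (key (min (X.graph.dist (h.vertex 2) (h.vertex v))
        (X.graph.dist (h.vertex 3) (h.vertex v)) + 1) ?_).2 ?_⟩ <;> omega

end Describes

end EdgeMetric

/-! ### Edge metric generators as covers of the pairs of edges. -/

namespace EdgeMetric

open StackProgram Var Finset

/-- Pairs of edges, given by their ends. -/
abbrev EdgePair (V : Type*) : Type _ := V × V × V × V

/-- The vertex `v` distinguishes the edges of a pair. -/
def Separates {V : Type*} (G : SimpleGraph V) (v : V) (τ : EdgePair V) : Prop :=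
  Distinguishes G v s(τ.1, τ.2.1) s(τ.2.2.1, τ.2.2.2)

open Classical in
/-- The pairs of different edges of a graph. -/
noncomputable def edgePairs {V : Type*} [Fintype V] (G : SimpleGraph V) : Finset (EdgePair V) :=
  univ.filter fun τ => G.Adj τ.1 τ.2.1 ∧ G.Adj τ.2.2.1 τ.2.2.2 ∧ s(τ.1, τ.2.1) ≠ s(τ.2.2.1, τ.2.2.2)

theorem mem_edgePairs {V : Type*} [Fintype V] {G : SimpleGraph V} {τ : EdgePair V} :
    τ ∈ edgePairs G ↔
      G.Adj τ.1 τ.2.1 ∧ G.Adj τ.2.2.1 τ.2.2.2 ∧ s(τ.1, τ.2.1) ≠ s(τ.2.2.1, τ.2.2.2) := by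
  classical
  simp [edgePairs]

theorem covers_iff {V : Type*} [Fintype V] (G : SimpleGraph V) (S : Finset V) :
    (∀ τ ∈ edgePairs G, ∃ v ∈ S, Separates G v τ) ↔ IsEdgeMetricGenerator G S := by
  constructor
  · intro h e₁ he₁ e₂ he₂ hne
    induction e₁ with | _ a b
    induction e₂ with | _ c d
    exact h (a, b, c, d) (mem_edgePairs.2 ⟨he₁, he₂, hne⟩)
  · intro h τ hτ
    obtain ⟨h₁, h₂, h₃⟩ := mem_edgePairs.1 hτ
    exact h _ h₁ _ h₂ h₃

/-- An end of one edge that is not on the other has distance zero to the first and positive distance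
to the second. If both ends of the first edge lay on the second, the edges would coincide. -/
theorem isEdgeMetricGenerator_univ {V : Type*} [Fintype V] {G : SimpleGraph V}
    (hG : G.Connected) : IsEdgeMetricGenerator G univ := by
  have key : ∀ a b c d : V, a ≠ c → a ≠ d → Distinguishes G a s(a, b) s(c, d) := by
    intro a b c d hc hd
    rw [Distinguishes, edgeDist_mk, edgeDist_mk, SimpleGraph.dist_self]
    have h₁ := hG.pos_dist_of_ne hc.symm
    have h₂ := hG.pos_dist_of_ne hd.symm
    omega
  intro e₁ he₁ e₂ he₂ hne
  induction e₁ with | _ a b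
  induction e₂ with | _ c d
  by_cases h₁ : a ≠ c ∧ a ≠ d
  · exact ⟨a, mem_univ a, key a b c d h₁.1 h₁.2⟩
  by_cases h₂ : b ≠ c ∧ b ≠ d
  · refine ⟨b, mem_univ b, ?_⟩
    rw [Sym2.eq_swap]
    exact key b a c d h₂.1 h₂.2
  exfalso
  have hab : a ≠ b := SimpleGraph.Adj.ne he₁
  apply hne
  rw [Sym2.eq_iff]
  grind

theorem exists_generator_card_eq_edim {V : Type*} [Fintype V] {G : SimpleGraph V}
    (hG : G.Connected) : ∃ K : Finset V, IsEdgeMetricGenerator G K ∧ K.card = edim G :=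
  Nat.sInf_mem (s := {k : ℕ | ∃ S : Finset V, IsEdgeMetricGenerator G S ∧ S.card = k})
    ⟨_, univ, isEdgeMetricGenerator_univ hG, rfl⟩

theorem edim_le_card {V : Type*} {G : SimpleGraph V} {S : Finset V}
    (hS : IsEdgeMetricGenerator G S) : edim G ≤ S.card :=
  Nat.sInf_le ⟨S, hS, rfl⟩

theorem card_adj_eq {V : Type*} [Fintype V] [DecidableEq V] (G : SimpleGraph V)
    [DecidableRel G.Adj] :
    (univ.filter fun p : V × V => G.Adj p.1 p.2).card = 2 * G.edgeSet.ncard := by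
  rw [← SimpleGraph.coe_edgeFinset, Set.ncard_coe_finset, ← G.dart_card_eq_twice_card_edges,
    ← Fintype.card_subtype]
  exact Fintype.card_congr
    ⟨fun p => ⟨p.1, p.2⟩, fun d => ⟨d.toProd, d.adj⟩, fun _ => rfl, fun _ => rfl⟩

/-- Each edge has two orderings of its ends, so there are (2m)² quadruples describing two edges. -/
theorem card_edgePairs_le {V : Type*} [Fintype V] (G : SimpleGraph V) :
    (edgePairs G).card ≤ (2 * G.edgeSet.ncard) ^ 2 := by
  classical
  rw [sq, ← card_adj_eq, ← card_product]
  refine card_le_card_of_injOn (fun τ => ((τ.1, τ.2.1), (τ.2.2.1, τ.2.2.2))) ?_ ?_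
  · intro τ hτ
    obtain ⟨h₁, h₂, -⟩ := mem_edgePairs.1 hτ
    simp [h₁, h₂]
  · rintro ⟨a, b, c, d⟩ - ⟨a', b', c', d'⟩ - h
    simpa [and_assoc] using h

theorem edgePairs_eq_empty {V : Type*} [Fintype V] {G : SimpleGraph V}
    (h : G.edgeSet.ncard ≤ 1) : edgePairs G = ∅ := by
  refine eq_empty_of_forall_notMem fun τ hτ => ?_
  obtain ⟨h₁, h₂, h₃⟩ := mem_edgePairs.1 hτ
  exact h₃ ((Set.ncard_le_one (Set.toFinite _)).1 h _ h₁ _ h₂)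

/-! ### Correctness of the greedy formula. -/

namespace Describes

variable {X : ConnectedGraph} {E : Env}

/-- The pair of edges between the values of the variables `0`, `1` and `2`, `3`. -/
def pair (h : Describes X E) : EdgePair (Fin X.order) :=
  (h.vertex 0, h.vertex 1, h.vertex 2, h.vertex 3)

theorem eval_fresh (h : Describes X E) {S : Finset (Fin X.order)}
    (hS : ∀ i : Fin X.order, E.sets 0 i = true ↔ i ∈ S) {v : Fin 11} (h₇ : v ≠ 7) (h₈ : v ≠ 8) :
    (Formula.fresh v).eval E = true ↔
      h.pair ∈ GreedyCover.uncovered (edgePairs X.graph) (Separates X.graph) S ∧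
        Separates X.graph (h.vertex v) h.pair := by
  have hadj : ∀ x y, E.adj (E.val (vtx x)) (E.val (vtx y)) = true ↔
      X.graph.Adj (h.vertex x) (h.vertex y) := by
    intro x y
    rw [h.adj]
    exact X.adj_iff (h.vertex x) (h.vertex y)
  have hex : (Formula.ex 6 (.conj (.mem 0 6) (.dist 6))).eval E = true ↔
      ∃ s ∈ S, Separates X.graph s h.pair := by
    rw [Formula.eval_ex]
    have hd : ∀ i (hi : i < E.n), (Formula.dist 6).eval (E.setVal (vtx 6) i) = true ↔
        Separates X.graph ⟨i, hi.trans_eq h.n⟩ h.pair := by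
      intro i hi
      rw [(h.setVal 6 hi).eval_dist (by decide) (by decide)]
      simp [vertex, Separates, pair]
    constructor
    · rintro ⟨i, hi, h'⟩
      rw [Formula.eval_conj, hd i hi, Formula.eval_mem, Env.setVal_self, Env.setVal_sets] at h'
      exact ⟨⟨i, hi.trans_eq h.n⟩, (hS ⟨i, hi.trans_eq h.n⟩).1 h'.1, h'.2⟩
    · rintro ⟨s, hs, h'⟩
      have hi : (s : ℕ) < E.n := s.2.trans_eq h.n.symm
      refine ⟨s, hi, ?_⟩
      rw [Formula.eval_conj, hd s hi, Formula.eval_mem, Env.setVal_self, Env.setVal_sets]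
      exact ⟨(hS s).2 hs, h'⟩
  rw [Formula.fresh, Formula.eval_conj, Formula.eval_conj, Formula.eval_conj, Formula.eval_neg,
    hex, h.eval_dist h₇ h₈, Formula.eval_adj, Formula.eval_adj, hadj, hadj]
  rw [GreedyCover.mem_uncovered, mem_edgePairs]
  constructor
  · rintro ⟨⟨h₁, h₂⟩, h₃, h₄⟩
    -- The formula does not say that the edges differ; being distinguished by `v` implies it.
    refine ⟨⟨⟨h₁, h₂, fun heq => h₄ ?_⟩, fun s hs hd => h₃ ⟨s, hs, hd⟩⟩, h₄⟩
    rw [show s(h.vertex 0, h.vertex 1) = s(h.vertex 2, h.vertex 3) from heq]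
  · rintro ⟨⟨⟨h₁, h₂, -⟩, h₃⟩, h₄⟩
    exact ⟨⟨h₁, h₂⟩, fun ⟨s, hs, hd⟩ => h₃ s hs hd, h₄⟩

/-- The condition `3 < v` keeps `v` from being overwritten by the four variables for the ends. -/
theorem eval_fresh_setVal (h : Describes X E) {S : Finset (Fin X.order)}
    (hS : ∀ i : Fin X.order, E.sets 0 i = true ↔ i ∈ S) {v : Fin 11} (h₃ : 3 < v) (h₇ : v ≠ 7)
    (h₈ : v ≠ 8) (a b c d : Fin X.order) :
    (Formula.fresh v).eval ((((E.setVal (vtx 0) a).setVal (vtx 1) b).setVal (vtx 2) c).setVal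
      (vtx 3) d) = true ↔
      (a, b, c, d) ∈ GreedyCover.uncovered (edgePairs X.graph) (Separates X.graph) S ∧
        Separates X.graph (h.vertex v) (a, b, c, d) := by
  have hlt : ∀ i : Fin X.order, (i : ℕ) < E.n := fun i => i.2.trans_eq h.n.symm
  have h' := ((((h.setVal 0 (hlt a)).setVal 1 (hlt b)).setVal 2 (hlt c)).setVal 3 (hlt d))
  rw [h'.eval_fresh (S := S) (by simpa using hS) h₇ h₈]
  have e₁ : h'.pair = (a, b, c, d) := by simp [pair, vertex]
  have e₂ : h'.vertex v = h.vertex v := by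
    have n₀ : v ≠ 0 := by rintro rfl; revert h₃; decide
    have n₁ : v ≠ 1 := by rintro rfl; revert h₃; decide
    have n₂ : v ≠ 2 := by rintro rfl; revert h₃; decide
    have n₃ : v ≠ 3 := by rintro rfl; revert h₃; decide
    simp [vertex, n₀, n₁, n₂, n₃]
  rw [e₁, e₂]

theorem tally_fresh (h : Describes X E) {S : Finset (Fin X.order)}
    (hS : ∀ i : Fin X.order, E.sets 0 i = true ↔ i ∈ S) {v : Fin 11} (h₃ : 3 < v) (h₇ : v ≠ 7)
    (h₈ : v ≠ 8) :
    E.tally (Formula.fresh v).eval [0, 1, 2, 3] =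
      GreedyCover.gain (edgePairs X.graph) (Separates X.graph) S (h.vertex v) := by
  classical
  have e : GreedyCover.gain (edgePairs X.graph) (Separates X.graph) S (h.vertex v) =
      (univ.filter fun τ : EdgePair (Fin X.order) =>
        τ ∈ GreedyCover.uncovered (edgePairs X.graph) (Separates X.graph) S ∧
        Separates X.graph (h.vertex v) τ).card := by
    rw [GreedyCover.gain]
    congr 1
    ext τ
    simp
  rw [e, card_filter, Fintype.sum_prod_type]
  simp only [Fintype.sum_prod_type, Env.tally, Env.setVal_n, h.n, sum_range]
  refine sum_congr rfl fun a _ => sum_congr rfl fun b _ => sum_congr rfl fun c _ =>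
    sum_congr rfl fun d _ => ?_
  rw [← if_congr (h.eval_fresh_setVal hS h₃ h₇ h₈ a b c d) rfl rfl]
  cases Formula.eval _ _ <;> simp

theorem eval_less (h : Describes X E) {S : Finset (Fin X.order)}
    (hS : ∀ i : Fin X.order, E.sets 0 i = true ↔ i ∈ S) {v w : Fin 11} (h₃ : 3 < v) (h₇ : v ≠ 7)
    (h₈ : v ≠ 8) (h₃' : 3 < w) (h₇' : w ≠ 7) (h₈' : w ≠ 8) :
    (Formula.less v w).eval E = true ↔
      GreedyCover.gain (edgePairs X.graph) (Separates X.graph) S (h.vertex v) <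
        GreedyCover.gain (edgePairs X.graph) (Separates X.graph) S (h.vertex w) := by
  rw [Formula.less, Formula.eval, Formula.eval, Formula.eval_lt, h.tally_fresh hS h₃ h₇ h₈,
    (h.setNum 0 _).tally_fresh (S := S) hS h₃' h₇' h₈']
  simp [vertex]

theorem eval_gains (h : Describes X E) {S : Finset (Fin X.order)}
    (hS : ∀ i : Fin X.order, E.sets 0 i = true ↔ i ∈ S) {v : Fin 11} (h₃ : 3 < v) (h₇ : v ≠ 7)
    (h₈ : v ≠ 8) :
    (Formula.gains v).eval E = true ↔
      0 < GreedyCover.gain (edgePairs X.graph) (Separates X.graph) S (h.vertex v) := by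
  have hlt : ∀ i : Fin X.order, (i : ℕ) < E.n := fun i => i.2.trans_eq h.n.symm
  simp only [Formula.gains, Formula.eval_ex, Env.setVal_n]
  rw [GreedyCover.gain_pos_iff]
  constructor
  · rintro ⟨a, ha, b, hb, c, hc, d, hd, h'⟩
    rw [h.n] at ha hb hc hd
    have := (h.eval_fresh_setVal hS h₃ h₇ h₈ ⟨a, ha⟩ ⟨b, hb⟩ ⟨c, hc⟩ ⟨d, hd⟩).1 h'
    exact ⟨_, this⟩
  · rintro ⟨⟨a, b, c, d⟩, h'⟩
    exact ⟨a, hlt a, b, hlt b, c, hlt c, d, hlt d,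
      (h.eval_fresh_setVal hS h₃ h₇ h₈ a b c d).2 h'⟩

theorem eval_greedy (h : Describes X E) {S : Finset (Fin X.order)}
    (hS : ∀ i : Fin X.order, E.sets 0 i = true ↔ i ∈ S) :
    Formula.greedy.eval E = true ↔
      h.vertex 4 ∈ GreedyCover.step (edgePairs X.graph) (Separates X.graph) S := by
  have hlt : ∀ i : Fin X.order, (i : ℕ) < E.n := fun i => i.2.trans_eq h.n.symm
  have e₄ : ∀ i (hi : i < E.n), (h.setVal 5 hi).vertex 4 = h.vertex 4 := by
    intro i hi; simp [vertex]
  have e₅ : ∀ i (hi : i < E.n), (h.setVal 5 hi).vertex 5 = ⟨i, hi.trans_eq h.n⟩ := by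
    intro i hi; simp [vertex]
  have h₁ : ∀ i (hi : i < E.n), (Formula.less 4 5).eval (E.setVal (vtx 5) i) = true ↔
      GreedyCover.gain (edgePairs X.graph) (Separates X.graph) S (h.vertex 4) <
        GreedyCover.gain (edgePairs X.graph) (Separates X.graph) S ⟨i, hi.trans_eq h.n⟩ := by
    intro i hi
    rw [(h.setVal 5 hi).eval_less (S := S) hS (by decide) (by decide) (by decide)
      (by decide) (by decide) (by decide), e₄ i hi, e₅ i hi]
  have h₂ : ∀ i (hi : i < E.n), (Formula.less 5 4).eval (E.setVal (vtx 5) i) = true ↔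
      GreedyCover.gain (edgePairs X.graph) (Separates X.graph) S ⟨i, hi.trans_eq h.n⟩ <
        GreedyCover.gain (edgePairs X.graph) (Separates X.graph) S (h.vertex 4) := by
    intro i hi
    rw [(h.setVal 5 hi).eval_less (S := S) hS (by decide) (by decide) (by decide)
      (by decide) (by decide) (by decide), e₄ i hi, e₅ i hi]
  rw [Formula.greedy, Formula.eval_disj, Formula.eval_conj, Formula.eval_conj, Formula.eval_neg,
    Formula.eval_neg, Formula.eval_ex, Formula.eval_ex,
    h.eval_gains hS (by decide) (by decide) (by decide)]
  rw [GreedyCover.mem_step, GreedyCover.IsChoice]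
  refine or_congr (hS (h.vertex 4)) (and_congr_right fun _ => and_congr ?_ ?_)
  · constructor
    · intro hno w
      by_contra hw
      exact hno ⟨w, hlt w, (h₁ w (hlt w)).2 (not_le.1 hw)⟩
    · rintro hle ⟨i, hi, hi'⟩
      exact absurd ((h₁ i hi).1 hi') (not_lt.2 (hle _))
  · constructor
    · intro hno w hw
      by_contra hw'
      refine hno ⟨w, hlt w, ?_⟩
      rw [Formula.eval_conj, Formula.eval_neg, Formula.eval_lt, h₂ w (hlt w)]
      refine ⟨?_, hw'⟩
      rw [Env.setVal_self, Env.setVal_of_ne _ (by decide)]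
      exact hw
    · rintro hall ⟨i, hi, hi'⟩
      rw [Formula.eval_conj, Formula.eval_neg, Formula.eval_lt, h₂ i hi] at hi'
      refine hi'.2 (hall _ ?_)
      have := hi'.1
      rw [Env.setVal_self, Env.setVal_of_ne _ (by decide)] at this
      exact this

end Describes

theorem outputSet_greedy (X : ConnectedGraph) :
    outputSet Formula.greedy 4 X =
      (GreedyCover.step (edgePairs X.graph) (Separates X.graph))^[X.order] ∅ := by
  have key : ∀ t (i : Fin X.order), (Formula.greedy.operator 4 X.order X.adj)^[t]
      (fun _ => false) i = true ↔
      i ∈ (GreedyCover.step (edgePairs X.graph) (Separates X.graph))^[t] ∅ := by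
    intro t
    induction t with
    | zero => simp
    | succ t ih =>
      intro i
      rw [Function.iterate_succ_apply', Function.iterate_succ_apply']
      -- The initial value 0 of the variables is a vertex, as the existence of `i` shows.
      have h₀ : Describes X (Env.init X.order X.adj) := ⟨rfl, rfl, fun _ => i.pos⟩
      have h := (h₀.setSet 0 ((Formula.greedy.operator 4 X.order X.adj)^[t]
        fun _ => false)).setVal 4 (i := i) i.2
      have := h.eval_greedy (S := (GreedyCover.step (edgePairs X.graph)
        (Separates X.graph))^[t] ∅) (by simpa using ih)
      have e : h.vertex 4 = i := by simp [Describes.vertex]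
      rw [e] at this
      exact this
  ext i
  rw [outputSet, mem_filter, key]
  simp

theorem isEdgeMetricGenerator_greedy (X : ConnectedGraph) :
    IsEdgeMetricGenerator X.graph (outputSet Formula.greedy 4 X) := by
  rw [outputSet_greedy, ← covers_iff]
  have h := GreedyCover.uncovered_iterate (K := univ)
    ((covers_iff X.graph univ).2 (isEdgeMetricGenerator_univ X.connected))
  rw [Fintype.card_fin] at h
  intro τ hτ
  by_contra hno
  push Not at hno
  exact notMem_empty τ (h ▸ GreedyCover.mem_uncovered.2 ⟨hτ, hno⟩)

theorem card_greedy_le (X : ConnectedGraph) :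
    ((outputSet Formula.greedy 4 X).card : ℝ) ≤
      6 * Real.log (X.size : ℝ) * (edim X.graph : ℝ) := by
  rw [outputSet_greedy]
  rcases Nat.lt_or_ge 1 X.size with hm | hm
  · obtain ⟨K, hK, hcard⟩ := exists_generator_card_eq_edim X.connected
    have h := GreedyCover.card_iterate_le ((covers_iff X.graph K).2 hK) X.order
    refine h.trans ?_
    -- Two different edges exist, so a generator is not empty. This lets the additive 1 be absorbed
    -- into the product.
    have hk : 1 ≤ K.card := by
      rw [Nat.one_le_iff_ne_zero, ne_eq, card_eq_zero]
      rintro rfl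
      obtain ⟨e₁, he₁, e₂, he₂, hne⟩ := (Set.one_lt_ncard (Set.toFinite _)).1 hm
      obtain ⟨v, hv, -⟩ := hK e₁ he₁ e₂ he₂ hne
      simp at hv
    have hm' : (2 : ℝ) ≤ X.size := by exact_mod_cast hm
    have hlog2 : Real.log 2 ≤ Real.log X.size := Real.log_le_log two_pos hm'
    -- From |U| ≤ (2m)² the logarithm is at most 2 log 2 + 2 log m, and log 2 ≤ log m. The empty
    -- case uses the convention `Real.log 0 = 0`.
    have hlog : Real.log (edgePairs X.graph).card ≤ 4 * Real.log X.size := by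
      rcases Nat.eq_zero_or_pos (edgePairs X.graph).card with h0 | h0
      · rw [h0, Nat.cast_zero, Real.log_zero]
        have := Real.log_two_gt_d9
        linarith
      · have h₁ : ((edgePairs X.graph).card : ℝ) ≤ (2 * X.size) ^ 2 := by
          exact_mod_cast card_edgePairs_le X.graph
        have h₂ := Real.log_le_log (by exact_mod_cast h0) h₁
        rw [Real.log_pow, Real.log_mul two_ne_zero (by positivity)] at h₂
        push_cast at h₂
        linarith
    have hk' : (1 : ℝ) ≤ K.card := by exact_mod_cast hk
    rw [← hcard]
    -- Since log 2 > 1/2, the additive 1 costs another 2 log m, which gives 4 + 2 = 6.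
    have h1 : 1 ≤ 2 * Real.log X.size := by
      have := Real.log_two_gt_d9
      linarith
    nlinarith [mul_le_mul_of_nonneg_left hlog (by linarith : (0 : ℝ) ≤ K.card)]
  · rw [GreedyCover.iterate_eq_empty (edgePairs_eq_empty hm), card_empty, Nat.cast_zero]
    have := Real.log_natCast_nonneg X.size
    positivity

end EdgeMetric

theorem mainTheorem4 :
    ∃ (C : ℝ) (alg : (X : EdgeMetric.ConnectedGraph) → Finset (Fin X.order)),
      Nonempty (Turing.TM2ComputableInPolyTime
        EdgeMetric.encodeGraph EdgeMetric.encodeVertexSet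
        (fun X : EdgeMetric.ConnectedGraph =>
          (⟨X.order, alg X⟩ : Σ n : ℕ, Finset (Fin n)))) ∧
      ∀ X : EdgeMetric.ConnectedGraph,
        EdgeMetric.IsEdgeMetricGenerator X.graph (alg X) ∧
        EdgeMetric.edim X.graph ≤ (alg X).card ∧
        ((alg X).card : ℝ) ≤ C * Real.log (X.size : ℝ) * (EdgeMetric.edim X.graph : ℝ) :=
  ⟨6, EdgeMetric.outputSet StackProgram.Formula.greedy 4,
    EdgeMetric.computable_outputSet _ _, fun X =>
      ⟨EdgeMetric.isEdgeMetricGenerator_greedy X,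
        EdgeMetric.edim_le_card (EdgeMetric.isEdgeMetricGenerator_greedy X),
        EdgeMetric.card_greedy_le X⟩⟩
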